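/- Rectangles are closed, nondegenerate (both side lengths positive) axis-parallel rectangles in the plane $\mathbb{R}^2$. A partition of a rectangle $C$ is a finite family of pairwise interior-disjoint rectangles whose union is $C$. Let $m\ge 0$ be an integer. (1) Let $C$ (the cake) be a rectangle and let $Z_1,\dots,Z_m$ (the toppings) be pairwise interior-disjoint rectangles contained in $C$. Then for some integer $b\ge 0$ with $b\le m-\lceil 2\sqrt m-1\rceil$ there is a partition of $C$ into $m+b$ rectangles $Z'_1,\dots,Z'_{m+b}$ such that $Z_i\subseteq Z'_i$ for all $1\le i\le m$. (2) The bound is tight for every $m$: there exist a rectangle $C$ and pairwise disjoint rectangles $Z_1,\dots,Z_m$ contained in $C$ such that the smallest $b\ge 0$ for which $C$ has a partition into $m+b$ rectangles $Z'_1,\dots,Z'_{m+b}$ with $Z_i\subseteq Z'_i$ for all $1\le i\le m$ is exactly $b=m-\lceil 2\sqrt m-1\rceil$. -/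

import Mathlib

open Set

/-- A closed, nondegenerate rectangle in the plane with sides parallel to the axes, given by the
coordinates of its sides. -/
structure AxisRect where
  left : ℝ
  right : ℝ
  bottom : ℝ
  top : ℝ
  left_lt_right : left < right
  bottom_lt_top : bottom < top

namespace AxisRect

/-- The set of points of the rectangle. -/
def toSet (R : AxisRect) : Set (ℝ × ℝ) :=
  Icc R.left R.right ×ˢ Icc R.bottom R.top

/-- Two rectangles do not overlap: they have disjoint interiors (they may touch). -/
def InteriorDisjoint (R S : AxisRect) : Prop :=
  Disjoint (interior R.toSet) (interior S.toSet)

/-- The rectangles `P 0, …, P (n - 1)` partition the cake `C`: their union is `C` and they are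
pairwise interior-disjoint. -/
structure IsPartition (C : AxisRect) {n : ℕ} (P : Fin n → AxisRect) : Prop where
  iUnion_eq : ⋃ i, (P i).toSet = C.toSet
  pairwise_interiorDisjoint : Pairwise fun i j => (P i).InteriorDisjoint (P j)

/-- The cake `C` has a partition into `m + b` rectangles such that, for each `i < m`, the `i`-th
piece contains the topping `Z i`; the last `b` pieces are the blanks. -/
def HasPartitionWithBlanks (C : AxisRect) {m : ℕ} (Z : Fin m → AxisRect) (b : ℕ) : Prop :=
  ∃ P : Fin (m + b) → AxisRect, IsPartition C P ∧
    ∀ i : Fin m, (Z i).toSet ⊆ (P (Fin.castAdd b i)).toSet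

end AxisRect

/-! Boxes are recorded by signed extents in the four directions, so that one argument covers all
rotations and reflections.

Upper bound: expand the toppings until no side of any can move (`Packed.exists_stuck`). Every
maximal empty box is then a hole, surrounded by a pinwheel of four boxes (`IsMaxEmpty.isHole`).
Overlapping holes coincide (`IsHole.eq_of_not_disj`), so boxes and holes partition the cake. Let
there be `h` holes and put `D = m - h`; induction on `m` gives `4 * m ≤ (D + 1) ^ 2`
(`exists_card_holes_add_eq`). Holes inject into the boxes touching neither of two adjacent sides of
the cake (`card_holes_add_le`), so some side is touched by only `k ≤ (D + 1) / 2` boxes. Removing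
these destroys at most `k - 1` holes (`exists_holes_nontouching`), so `D` drops by at least one.
Hence `4 * m ≤ D ^ 2 + 4 * k ≤ (D + 1) ^ 2 + 1`, and squares modulo 4 remove the last 1.

Tightness: in a basket weave of nearly square shape, no piece containing a topping reaches a gap
between four toppings, and no blank reaches two gaps (`le_of_hasPartitionWithBlanks_weave`). -/

/-! ### Boxes as extents in four directions -/

/-- An axis-parallel rectangle given by how far it extends in the four directions right, top, left,
bottom (in this order, and with a sign: direction `d + 2` is opposite to `d`). -/
abbrev Extents := Fin 4 → ℝ

namespace Extents

/-- The directions `a, b, c, e` follow each other clockwise or counterclockwise. -/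
def Quad (a b c e : Fin 4) : Prop := c = a + 2 ∧ e = b + 2 ∧ (b = a + 1 ∨ b = a + 3)

instance (a b c e : Fin 4) : Decidable (Quad a b c e) := by unfold Quad; infer_instance

theorem quad_self : ∀ d : Fin 4, Quad d (d + 1) (d + 2) (d + 3) := by decide

namespace Quad

variable {a b c e : Fin 4}

theorem rotate (q : Quad a b c e) : Quad b c e a := by
  revert a b c e; decide

theorem reflect (q : Quad a b c e) : Quad a e c b := by
  revert a b c e; decide

theorem eq_or (q : Quad a b c e) (d : Fin 4) : d = a ∨ d = b ∨ d = c ∨ d = e := by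
  revert a b c e d; decide

theorem add_two (q : Quad a b c e) : a + 2 = c ∧ b + 2 = e ∧ c + 2 = a ∧ e + 2 = b := by
  revert a b c e; decide

theorem ne (q : Quad a b c e) : a ≠ b ∧ a ≠ c ∧ a ≠ e ∧ b ≠ c ∧ b ≠ e ∧ c ≠ e := by
  revert a b c e; decide

theorem forall_iff (q : Quad a b c e) {P : Fin 4 → Prop} :
    (∀ d, P d) ↔ P a ∧ P b ∧ P c ∧ P e := by
  refine ⟨fun h => ⟨h a, h b, h c, h e⟩, fun ⟨ha, hb, hc, he⟩ d => ?_⟩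
  rcases q.eq_or d with rfl | rfl | rfl | rfl <;> assumption

theorem exists_iff (q : Quad a b c e) {P : Fin 4 → Prop} :
    (∃ d, P d) ↔ P a ∨ P b ∨ P c ∨ P e := by
  constructor
  · rintro ⟨d, hd⟩
    rcases q.eq_or d with rfl | rfl | rfl | rfl <;> tauto
  · rintro (h | h | h | h) <;> exact ⟨_, h⟩

end Quad

/-- Both side lengths are positive. -/
def Pos (A : Extents) : Prop := ∀ d, 0 < A d + A (d + 2)

/-- The interiors are disjoint. -/
def Disj (A B : Extents) : Prop := ∃ d, A d + B (d + 2) ≤ 0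

/-- The side of `A` in direction `d` touches `B` along a segment. -/
def Blocks (d : Fin 4) (A B : Extents) : Prop :=
  A d + B (d + 2) = 0 ∧ 0 < A (d + 1) + B (d + 3) ∧ 0 < A (d + 3) + B (d + 1)

variable {a b c e : Fin 4} {A B C E : Extents}

theorem Quad.le_iff (q : Quad a b c e) :
    A ≤ B ↔ A a ≤ B a ∧ A b ≤ B b ∧ A c ≤ B c ∧ A e ≤ B e := by
  rw [Pi.le_def, q.forall_iff]

theorem Quad.pos_iff (q : Quad a b c e) : Pos A ↔ 0 < A a + A c ∧ 0 < A b + A e := by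
  rw [Pos, q.forall_iff, q.add_two.1, q.add_two.2.1, q.add_two.2.2.1, q.add_two.2.2.2,
    add_comm (A c), add_comm (A e)]
  tauto

theorem Quad.disj_iff (q : Quad a b c e) :
    Disj A B ↔ A a + B c ≤ 0 ∨ A b + B e ≤ 0 ∨ A c + B a ≤ 0 ∨ A e + B b ≤ 0 := by
  rw [Disj, q.exists_iff, q.add_two.1, q.add_two.2.1, q.add_two.2.2.1, q.add_two.2.2.2]

theorem Quad.blocks_iff (q : Quad a b c e) :
    Blocks a A B ↔ A a + B c = 0 ∧ 0 < A b + B e ∧ 0 < A e + B b := by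
  have h : c = a + 2 ∧ (b = a + 1 ∧ e = a + 3 ∨ b = a + 3 ∧ e = a + 1) := by
    revert a b c e; decide
  obtain ⟨rfl, ⟨rfl, rfl⟩ | ⟨rfl, rfl⟩⟩ := h
  · rfl
  · unfold Blocks; tauto

theorem Disj.symm (h : Disj A B) : Disj B A := by
  rw [(quad_self 0).disj_iff] at h ⊢
  rcases h with h | h | h | h <;> rw [add_comm] at h <;> tauto

theorem Disj.mono (h : Disj A B) {A' B' : Extents} (hA : A' ≤ A) (hB : B' ≤ B) : Disj A' B' := by
  obtain ⟨d, hd⟩ := h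
  exact ⟨d, (add_le_add (hA d) (hB _)).trans hd⟩

theorem Pos.mono (h : Pos A) (hA : A ≤ B) : Pos B :=
  fun d => (h d).trans_le (add_le_add (hA d) (hA _))

/-! ### Expanding boxes until they are stuck -/

variable {ι : Type*}

/-- `A` can not be extended in direction `d` within `C` and without overlapping the boxes `X i`. -/
def Stuck (s : Finset ι) (X : ι → Extents) (C A : Extents) (d : Fin 4) : Prop :=
  A d = C d ∨ ∃ i ∈ s, Blocks d A (X i)

theorem exists_stretch (s : Finset ι) (X : ι → Extents) (hC : A ≤ C)
    (hd : ∀ i ∈ s, Disj A (X i)) (d : Fin 4) :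
    ∃ B, A ≤ B ∧ B ≤ C ∧ (∀ d', d' ≠ d → B d' = A d') ∧ (∀ i ∈ s, Disj B (X i)) ∧
      Stuck s X C B d := by
  classical
  -- `O` collects the boxes ahead of `A` whose projections overlap its side; that side moves up to
  -- the nearest of them or to the side of `C`.
  let O := s.filter fun i => A d + X i (d + 2) ≤ 0 ∧ 0 < A (d + 1) + X i (d + 3) ∧
    0 < A (d + 3) + X i (d + 1)
  let V := insert (C d) (O.image fun i => - X i (d + 2))
  have hV : V.Nonempty := ⟨C d, Finset.mem_insert_self _ _⟩
  set v := V.min' hV with hv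
  have q := quad_self d
  have hvC : v ≤ C d := Finset.min'_le _ _ (Finset.mem_insert_self _ _)
  have hvO : ∀ i ∈ O, v ≤ - X i (d + 2) := fun i hi =>
    Finset.min'_le _ _ (Finset.mem_insert_of_mem (Finset.mem_image_of_mem _ hi))
  have hAv : A d ≤ v := by
    refine Finset.le_min' _ _ _ fun y hy => ?_
    rcases Finset.mem_insert.1 hy with rfl | hy
    · exact hC d
    · obtain ⟨i, hi, rfl⟩ := Finset.mem_image.1 hy
      have := (Finset.mem_filter.1 hi).2.1
      linarith
  have hne : ∀ d', d' ≠ d → Function.update A d v d' = A d' := fun d' h =>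
    Function.update_of_ne h _ _
  have hself : Function.update A d v d = v := Function.update_self _ _ _
  have h1 := hne _ q.ne.1.symm
  have h2 := hne _ q.ne.2.1.symm
  have h3 := hne _ q.ne.2.2.1.symm
  refine ⟨Function.update A d v, ?_, ?_, hne, ?_, ?_⟩
  · rw [q.le_iff, hself, h1, h2, h3]
    exact ⟨hAv, le_rfl, le_rfl, le_rfl⟩
  · rw [q.le_iff, hself, h1, h2, h3]
    exact ⟨hvC, hC _, hC _, hC _⟩
  · intro i hi
    have := hd i hi
    rw [q.disj_iff] at this ⊢
    rw [hself, h1, h2, h3]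
    by_cases h : i ∈ O
    · have := hvO i h
      left; linarith
    · have h' : ¬ (A d + X i (d + 2) ≤ 0 ∧ 0 < A (d + 1) + X i (d + 3) ∧
        0 < A (d + 3) + X i (d + 1)) := fun h' => h (Finset.mem_filter.2 ⟨hi, h'⟩)
      rcases this with this | this | this | this
      · by_cases h4 : 0 < A (d + 1) + X i (d + 3)
        · by_cases h5 : 0 < A (d + 3) + X i (d + 1)
          · exact absurd ⟨this, h4, h5⟩ h'
          · exact Or.inr (Or.inr (Or.inr (not_lt.1 h5)))
        · exact Or.inr (Or.inl (not_lt.1 h4))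
      · exact Or.inr (Or.inl this)
      · exact Or.inr (Or.inr (Or.inl this))
      · exact Or.inr (Or.inr (Or.inr this))
  · rcases Finset.mem_insert.1 (Finset.min'_mem V hV) with h | h
    · left; rw [hself, hv, h]
    · obtain ⟨i, hi, hiv⟩ := Finset.mem_image.1 h
      obtain ⟨his, -, h4, h5⟩ := Finset.mem_filter.1 hi
      refine Or.inr ⟨i, his, ?_⟩
      rw [q.blocks_iff, hself, h1, h3]
      refine ⟨?_, h4, h5⟩
      rw [hv, ← hiv]; ring

theorem Stuck.mono {s : Finset ι} {X : ι → Extents} {d : Fin 4} (h : Stuck s X C A d)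
    (hAB : A ≤ B) (hd : B d = A d) : Stuck s X C B d := by
  have q := quad_self d
  rcases h with h | ⟨i, hi, h⟩
  · exact Or.inl (hd.trans h)
  · refine Or.inr ⟨i, hi, ?_⟩
    rw [q.blocks_iff] at h ⊢
    have h1 := hAB (d + 1)
    have h3 := hAB (d + 3)
    exact ⟨by linarith, by linarith, by linarith⟩

/-- Every box that is disjoint from the boxes `X i` lies in a maximal such box. -/
theorem exists_le_stuck (s : Finset ι) (X : ι → Extents) (hC : A ≤ C)
    (hd : ∀ i ∈ s, Disj A (X i)) :
    ∃ B, A ≤ B ∧ B ≤ C ∧ (∀ i ∈ s, Disj B (X i)) ∧ ∀ d, Stuck s X C B d := by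
  obtain ⟨B, hAB, hB, -, hBd, hB0⟩ := exists_stretch s X hC hd 0
  obtain ⟨B', hAB', hB', he', hBd', hB1⟩ := exists_stretch s X hB hBd 1
  obtain ⟨B'', hAB'', hB'', he'', hBd'', hB2⟩ := exists_stretch s X hB' hBd' 2
  obtain ⟨D, hAD, hD, he, hDd, hB3⟩ := exists_stretch s X hB'' hBd'' 3
  refine ⟨D, ((hAB.trans hAB').trans hAB'').trans hAD, hD, hDd, ?_⟩
  have h0 := ((hB0.mono hAB' (he' 0 (by decide))).mono hAB'' (he'' 0 (by decide))).mono
    hAD (he 0 (by decide))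
  have h1 := (hB1.mono hAB'' (he'' 1 (by decide))).mono hAD (he 1 (by decide))
  have h2 := hB2.mono hAD (he 2 (by decide))
  rw [Fin.forall_fin_succ, Fin.forall_fin_succ, Fin.forall_fin_succ, Fin.forall_fin_one]
  exact ⟨h0, h1, h2, hB3⟩

/-- The boxes `X i` are nondegenerate, lie in `C` and have disjoint interiors. -/
structure Packed (s : Finset ι) (X : ι → Extents) (C : Extents) : Prop where
  pos : ∀ i ∈ s, Pos (X i)
  le : ∀ i ∈ s, X i ≤ C
  disj : ∀ i ∈ s, ∀ j ∈ s, i ≠ j → Disj (X i) (X j)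

theorem Blocks.symm {d : Fin 4} (h : Blocks d A B) : Blocks (d + 2) B A := by
  have q := quad_self d
  rw [q.blocks_iff] at h
  rw [q.rotate.rotate.blocks_iff]
  refine ⟨?_, ?_, ?_⟩ <;> linarith [h.1, h.2.1, h.2.2]

/-- Disjoint boxes in `C` can be expanded until none of them can be expanded further. -/
theorem Packed.exists_stuck {s : Finset ι} {X : ι → Extents} (h : Packed s X C) :
    ∃ Y : ι → Extents, (∀ i ∈ s, X i ≤ Y i) ∧ Packed s Y C ∧
      ∀ i ∈ s, ∀ d, Stuck s Y C (Y i) d := by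
  classical
  -- Each stretch makes one more pair (box, direction) stuck and frees none.
  induction hn : ((s ×ˢ (Finset.univ : Finset (Fin 4))).filter
    fun p => ¬ Stuck s X C (X p.1) p.2).card using Nat.strong_induction_on generalizing X with
  | _ n ih =>
  by_cases hall : ∀ i ∈ s, ∀ d, Stuck s X C (X i) d
  · exact ⟨X, fun i _ => le_rfl, h, hall⟩
  push Not at hall
  obtain ⟨i, hi, d, hid⟩ := hall
  obtain ⟨B, hAB, hBC, hne, hBd, hB⟩ := exists_stretch (s.erase i) X (h.le i hi)
    (fun j hj => h.disj i hi j (Finset.mem_of_mem_erase hj) (Finset.ne_of_mem_erase hj).symm) d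
  set Y := Function.update X i B with hY
  have hYi : Y i = B := Function.update_self _ _ _
  have hYj : ∀ j, j ≠ i → Y j = X j := fun j hj => Function.update_of_ne hj _ _
  have hXY : ∀ j, X j ≤ Y j := fun j => by
    by_cases hj : j = i
    · subst hj; rw [hYi]; exact hAB
    · rw [hYj j hj]
  have hpack : Packed s Y C := by
    refine ⟨fun j hj => (h.pos j hj).mono (hXY j), fun j hj => ?_, fun j hj k hk hjk => ?_⟩
    · by_cases hji : j = i
      · subst hji; rw [hYi]; exact hBC
      · rw [hYj j hji]; exact h.le j hj
    · by_cases hji : j = i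
      · subst hji
        rw [hYi, hYj k hjk.symm]
        exact hBd k (Finset.mem_erase.2 ⟨hjk.symm, hk⟩)
      · by_cases hki : k = i
        · subst hki
          rw [hYi, hYj j hjk]
          exact (hBd j (Finset.mem_erase.2 ⟨hjk, hj⟩)).symm
        · rw [hYj j hji, hYj k hki]
          exact h.disj j hj k hk hjk
  -- A stuck side does not move, and the side of the box blocking it is stuck as well, so their
  -- contact persists.
  have hstuck : ∀ j ∈ s, ∀ d', Stuck s X C (X j) d' → Stuck s Y C (Y j) d' := by
    intro j hj d' hjd
    have key : ∀ k ∈ s, ∀ d', Stuck s X C (X k) d' → Y k d' = X k d' := by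
      intro k hk d' hkd
      by_cases hki : k = i
      · subst hki
        rw [hYi]
        exact hne d' fun hd => hid (hd ▸ hkd)
      · rw [hYj k hki]
    rcases hjd with h1 | ⟨k, hk, h1⟩
    · exact Or.inl ((key j hj d' (Or.inl h1)).trans h1)
    · have e1 := key j hj d' (Or.inr ⟨k, hk, h1⟩)
      have e2 := key k hk (d' + 2) (Or.inr ⟨j, hj, h1.symm⟩)
      refine Or.inr ⟨k, hk, ?_⟩
      have l1 := hXY j (d' + 1)
      have l2 := hXY j (d' + 3)
      have l3 := hXY k (d' + 1)
      have l4 := hXY k (d' + 3)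
      obtain ⟨b1, b2, b3⟩ := h1
      exact ⟨by rw [e1, e2, b1], by linarith, by linarith⟩
  have hidY : Stuck s Y C (Y i) d := by
    rw [hYi]
    rcases hB with h1 | ⟨k, hk, h1⟩
    · exact Or.inl h1
    · refine Or.inr ⟨k, Finset.mem_of_mem_erase hk, ?_⟩
      rw [hYj k (Finset.ne_of_mem_erase hk)]
      exact h1
  obtain ⟨Z, hYZ, hZ, hZs⟩ := ih _ (by
    rw [← hn]
    refine Finset.card_lt_card ⟨fun p hp => ?_, fun hsub => ?_⟩
    · rw [Finset.mem_filter, Finset.mem_product] at hp ⊢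
      exact ⟨hp.1, fun hp' => hp.2 (hstuck _ hp.1.1 _ hp')⟩
    · have : (i, d) ∈ (s ×ˢ (Finset.univ : Finset (Fin 4))).filter
          fun p => ¬ Stuck s X C (X p.1) p.2 := by
        rw [Finset.mem_filter, Finset.mem_product]
        exact ⟨⟨hi, Finset.mem_univ _⟩, hid⟩
      exact (Finset.mem_filter.1 (hsub this)).2 hidY) hpack rfl
  exact ⟨Z, fun j hj => (hXY j).trans (hYZ j hj), hZ, hZs⟩

end Extents

/-! ### Maximal empty boxes are pinwheel holes -/

namespace Extents

variable {a b c e : Fin 4} {A B C E : Extents} {ι : Type*} {s : Finset ι} {X : ι → Extents}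

/-- Some box `X i` contains the side `a` of `E`, has one end in common with it in direction `e`,
and extends beyond it in direction `b`. -/
def Side (s : Finset ι) (X : ι → Extents) (E : Extents) (a b c e : Fin 4) : Prop :=
  ∃ i ∈ s, X i c = - E a ∧ X i e = E e ∧ E b < X i b

/-- The box `E` is surrounded by a pinwheel of four boxes `X i`, of the given orientation. -/
def Pinwheel (s : Finset ι) (X : ι → Extents) (E : Extents) (a b c e : Fin 4) : Prop :=
  Side s X E a b c e ∧ Side s X E b c e a ∧ Side s X E c e a b ∧ Side s X E e a b c

/-- The box `E` is disjoint from the boxes `X i` and surrounded by a pinwheel of four of them. -/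
structure IsHole (s : Finset ι) (X : ι → Extents) (E : Extents) : Prop where
  pos : Pos E
  disj : ∀ i ∈ s, Disj E (X i)
  pinwheel : Pinwheel s X E 0 1 2 3 ∨ Pinwheel s X E 0 3 2 1

theorem IsHole.pinwheel_or (h : IsHole s X E) (q : Quad a b c e) :
    Pinwheel s X E a b c e ∨ Pinwheel s X E a e c b := by
  have hq : (a = 0 ∧ b = 1 ∧ c = 2 ∧ e = 3) ∨ (a = 1 ∧ b = 2 ∧ c = 3 ∧ e = 0) ∨
      (a = 2 ∧ b = 3 ∧ c = 0 ∧ e = 1) ∨ (a = 3 ∧ b = 0 ∧ c = 1 ∧ e = 2) ∨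
      (a = 0 ∧ b = 3 ∧ c = 2 ∧ e = 1) ∨ (a = 3 ∧ b = 2 ∧ c = 1 ∧ e = 0) ∨
      (a = 2 ∧ b = 1 ∧ c = 0 ∧ e = 3) ∨ (a = 1 ∧ b = 0 ∧ c = 3 ∧ e = 2) := by
    obtain ⟨rfl, rfl, rfl | rfl⟩ := q <;> clear h <;> revert a <;> decide
  have h0 := h.pinwheel
  unfold Pinwheel at h0 ⊢
  rcases hq with ⟨rfl, rfl, rfl, rfl⟩ | ⟨rfl, rfl, rfl, rfl⟩ | ⟨rfl, rfl, rfl, rfl⟩ |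
    ⟨rfl, rfl, rfl, rfl⟩ | ⟨rfl, rfl, rfl, rfl⟩ | ⟨rfl, rfl, rfl, rfl⟩ | ⟨rfl, rfl, rfl, rfl⟩ |
    ⟨rfl, rfl, rfl, rfl⟩ <;> tauto

theorem IsHole.exists_pinwheel (h : IsHole s X E) :
    ∃ a b c e, Quad a b c e ∧ Pinwheel s X E a b c e := by
  rcases h.pinwheel with h | h
  · exact ⟨_, _, _, _, by decide, h⟩
  · exact ⟨_, _, _, _, by decide, h⟩

/-- A maximal box in `C` disjoint from the boxes `X i`. -/
structure IsMaxEmpty (s : Finset ι) (X : ι → Extents) (C E : Extents) : Prop where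
  pos : Pos E
  le : E ≤ C
  disj : ∀ i ∈ s, Disj E (X i)
  stuck : ∀ d, Stuck s X C E d

/-- What bounds `E` in direction `a` extends beyond `E` in direction `b`. -/
def Beyond (s : Finset ι) (X : ι → Extents) (C E : Extents) (a b : Fin 4) : Prop :=
  E a = C a ∨ ∃ i ∈ s, Blocks a E (X i) ∧ E b < X i b

section maximal

variable (hX : Packed s X C) (hs : ∀ i ∈ s, ∀ d, Stuck s X C (X i) d)

-- `X i` is itself stuck in direction `c`. If it overshot `E` at neither end, its obstacle there
-- would overlap `E`.
include hX hs in
theorem IsMaxEmpty.lt_or_lt (hE : IsMaxEmpty s X C E) (q : Quad a b c e) {i : ι} (hi : i ∈ s)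
    (h : Blocks a E (X i)) : E b < X i b ∨ E e < X i e := by
  have hp := q.pos_iff.1 hE.pos
  have hl := q.le_iff.1 hE.le
  rw [q.blocks_iff] at h
  rcases hs i hi c with h1 | ⟨j, hj, h1⟩
  · linarith
  · rw [q.rotate.rotate.blocks_iff] at h1
    have hpj := q.pos_iff.1 (hX.pos j hj)
    rcases q.disj_iff.1 (hE.disj j hj) with h2 | h2 | h2 | h2
    · linarith
    · left; linarith
    · linarith
    · right; linarith

-- The obstacle in direction `a` seals the corner: a box on side `b` getting past it would overlap
-- it or leave `C`.
include hX in
theorem IsMaxEmpty.le_of_beyond (hE : IsMaxEmpty s X C E) (q : Quad a b c e)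
    (hab : Beyond s X C E a b) {j : ι} (hj : j ∈ s) (h : Blocks b E (X j)) : X j a ≤ E a := by
  have hp := q.pos_iff.1 hE.pos
  rw [q.rotate.blocks_iff] at h
  rcases hab with h1 | ⟨i, hi, h1, h2⟩
  · exact h1 ▸ hX.le j hj a
  · rw [q.blocks_iff] at h1
    have hij : i ≠ j := by
      rintro rfl
      linarith
    have hpi := q.pos_iff.1 (hX.pos i hi)
    have hpj := q.pos_iff.1 (hX.pos j hj)
    rcases q.disj_iff.1 (hX.disj i hi j hj hij) with h3 | h3 | h3 | h3 <;> linarith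

-- The box on side `b` cannot overshoot towards `a`, so it overshoots towards `c`. Thus overshooting
-- propagates around `E`.
include hX hs in
theorem IsMaxEmpty.beyond_rotate (hE : IsMaxEmpty s X C E) (q : Quad a b c e)
    (hab : Beyond s X C E a b) : Beyond s X C E b c := by
  rcases hE.stuck b with h | ⟨j, hj, h⟩
  · exact Or.inl h
  · have h1 := hE.le_of_beyond hX q hab hj h
    rcases hE.lt_or_lt hX hs q.rotate hj h with h2 | h2
    · exact Or.inr ⟨j, hj, h, h2⟩
    · linarith

-- From a side on the boundary of `C`, overshooting propagates in both senses of rotation. A box on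
-- any other side would be sealed at both ends, so all sides lie on the boundary and `E = C` leaves
-- no room for a box.
include hX hs in
theorem IsMaxEmpty.lt (hE : IsMaxEmpty s X C E) (hne : s.Nonempty) (d : Fin 4) : E d < C d := by
  refine (hE.le d).lt_of_ne fun hd => ?_
  have q := quad_self d
  have b1 : Beyond s X C E d (d + 1) := Or.inl hd
  have b2 := hE.beyond_rotate hX hs q b1
  have b3 := hE.beyond_rotate hX hs q.rotate b2
  have b4 := hE.beyond_rotate hX hs q.rotate.rotate b3
  have c1 : Beyond s X C E d (d + 3) := Or.inl hd
  have c2 := hE.beyond_rotate hX hs q.reflect c1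
  have c3 := hE.beyond_rotate hX hs q.reflect.rotate c2
  have c4 := hE.beyond_rotate hX hs q.reflect.rotate.rotate c3
  have key : ∀ {a b c e : Fin 4}, Quad a b c e → Beyond s X C E b a → Beyond s X C E e a →
      E a = C a := by
    intro a b c e q hb he
    rcases hE.stuck a with h | ⟨j, hj, h⟩
    · exact h
    · have h1 := hE.le_of_beyond hX q.reflect.rotate.rotate.rotate hb hj h
      have h2 := hE.le_of_beyond hX q.rotate.rotate.rotate he hj h
      rcases hE.lt_or_lt hX hs q hj h with h3 | h3 <;> linarith
  have h1 := key q.rotate c3 b1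
  have h2 := key q.rotate.rotate c2 b2
  have h3 := key q.rotate.rotate.rotate c1 b3
  obtain ⟨i, hi⟩ := hne
  have hpi := q.pos_iff.1 (hX.pos i hi)
  have hl := q.le_iff.1 (hX.le i hi)
  rcases q.disj_iff.1 (hE.disj i hi) with h4 | h4 | h4 | h4 <;> linarith

include hX hs in
/-- A box that bounds a maximal empty box and extends beyond it at one end is aligned with it at
the other end. -/
theorem IsMaxEmpty.eq_of_beyond (hE : IsMaxEmpty s X C E) (q : Quad a b c e) (hlt : ∀ d, E d < C d)
    (hab : Beyond s X C E a b) {i : ι} (hi : i ∈ s) (h : Blocks a E (X i)) :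
    X i e = E e ∧ E b < X i b := by
  have hbc := hE.beyond_rotate hX hs q hab
  have hce := hE.beyond_rotate hX hs q.rotate hbc
  have hea := hE.beyond_rotate hX hs q.rotate.rotate hce
  have hie : X i e ≤ E e := hE.le_of_beyond hX q.rotate.rotate.rotate hea hi h
  have hib : E b < X i b := by
    rcases hE.lt_or_lt hX hs q hi h with h1 | h1
    · exact h1
    · linarith
  refine ⟨le_antisymm hie (not_lt.1 fun hlt' => ?_), hib⟩
  obtain ⟨k, hk, hkb⟩ := (hE.stuck e).resolve_left (hlt e).ne
  have hkc : X k c ≤ E c := hE.le_of_beyond hX q.rotate.rotate hce hk hkb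
  have pE := q.pos_iff.1 hE.pos
  have hi' := q.blocks_iff.1 h
  have hk' := q.rotate.rotate.rotate.blocks_iff.1 hkb
  have pi := q.pos_iff.1 (hX.pos i hi)
  have pk := q.pos_iff.1 (hX.pos k hk)
  -- `E₁` is the strip of `E` left free by `X i` near side `e`; it can be pushed out through side
  -- `a`.
  set E₁ : Extents := Function.update E b (- X i e) with hE₁
  have hb1 : E₁ b = - X i e := Function.update_self _ _ _
  have hn1 : ∀ d, d ≠ b → E₁ d = E d := fun d hd => Function.update_of_ne hd _ _
  have ha1 := hn1 a q.ne.1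
  have hc1 := hn1 c q.ne.2.2.2.1.symm
  have he1 := hn1 e q.ne.2.2.2.2.1.symm
  have hE₁E : E₁ ≤ E := by
    rw [q.le_iff, ha1, hb1, hc1, he1]
    exact ⟨le_rfl, by linarith, le_rfl, le_rfl⟩
  have hpos1 : Pos E₁ := by
    rw [q.pos_iff, ha1, hb1, hc1, he1]
    exact ⟨by linarith, by linarith⟩
  obtain ⟨E₂, h12, hE₂C, hn2, hd2, hs2⟩ := exists_stretch s X (hE₁E.trans hE.le)
    (fun j hj => (hE.disj j hj).mono hE₁E le_rfl) a
  have hb2 := hn2 b q.ne.1.symm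
  have hc2 := hn2 c q.ne.2.1.symm
  have he2 := hn2 e q.ne.2.2.1.symm
  have ha2 : E a < E₂ a := by
    refine lt_of_le_of_ne (ha1 ▸ h12 a) fun hEa => ?_
    rcases hs2 with h3 | ⟨t, ht, htb⟩
    · have := hlt a
      linarith
    -- A box `t` stopping the strip at once would bound `E` too, overshoot at `b`, and so overlap `X
    -- i`.
    · have ht' := q.blocks_iff.1 htb
      have hti : t ≠ i := by
        rintro rfl
        linarith
      have htE : Blocks a E (X t) := by
        rw [q.blocks_iff]
        exact ⟨by linarith, by linarith, by linarith⟩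
      have h3 : X t e ≤ E e := hE.le_of_beyond hX q.rotate.rotate.rotate hea ht htE
      have h4 : E b < X t b := by
        rcases hE.lt_or_lt hX hs q ht htE with h1 | h1
        · exact h1
        · linarith
      have pt := q.pos_iff.1 (hX.pos t ht)
      rcases q.disj_iff.1 (hX.disj t ht i hi hti) with h5 | h5 | h5 | h5 <;> linarith
  -- A maximal box around the stretched strip is bounded by `X i` and `k`. Its overshooting runs in
  -- the opposite sense, so `k` would have to overshoot towards `c`, against `hkc`.
  obtain ⟨E₃, h23, hE₃C, hd3, hs3⟩ := exists_le_stuck s X hE₂C hd2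
  have hE₃ : IsMaxEmpty s X C E₃ := ⟨(hpos1.mono h12).mono h23, hE₃C, hd3, hs3⟩
  have l3 := q.le_iff.1 h23
  have hb3 : E₃ b = - X i e := by
    rcases q.disj_iff.1 (hd3 i hi) with h5 | h5 | h5 | h5 <;> linarith
  have he3 : E₃ e = E e := by
    rcases q.disj_iff.1 (hd3 k hk) with h5 | h5 | h5 | h5 <;> linarith
  have hib3 : Blocks b E₃ (X i) := by
    rw [q.rotate.blocks_iff]
    exact ⟨by linarith, by linarith, by linarith⟩
  have hkb3 : Blocks e E₃ (X k) := by
    rw [q.rotate.rotate.rotate.blocks_iff]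
    exact ⟨by linarith, by linarith, by linarith⟩
  have hba3 : Beyond s X C E₃ b a := by
    rcases hE₃.lt_or_lt hX hs q.rotate hi hib3 with h5 | h5
    · linarith
    · exact Or.inr ⟨i, hi, hib3, h5⟩
  have q' := q.reflect.rotate.rotate.rotate
  have hae3 := hE₃.beyond_rotate hX hs q' hba3
  have hka := hE₃.le_of_beyond hX q'.rotate hae3 hk hkb3
  rcases hE₃.lt_or_lt hX hs q'.rotate.rotate hk hkb3 with h5 | h5 <;> linarith

include hX hs in
/-- In an arrangement that can not be expanded, the maximal empty boxes are holes. -/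
theorem IsMaxEmpty.isHole (hE : IsMaxEmpty s X C E) (hne : s.Nonempty) : IsHole s X E := by
  have hlt := hE.lt hX hs hne
  have side : ∀ {a b c e : Fin 4}, Quad a b c e → Beyond s X C E a b → Side s X E a b c e := by
    intro a b c e q hab
    obtain ⟨i, hi, hib⟩ := (hE.stuck a).resolve_left (hlt a).ne
    have h1 := hE.eq_of_beyond hX hs q hlt hab hi hib
    have h2 := (q.blocks_iff.1 hib).1
    exact ⟨i, hi, by linarith, h1⟩
  have wheel : ∀ {a b c e : Fin 4}, Quad a b c e → Beyond s X C E a b →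
      Pinwheel s X E a b c e := by
    intro a b c e q hab
    have hbc := hE.beyond_rotate hX hs q hab
    have hce := hE.beyond_rotate hX hs q.rotate hbc
    have hea := hE.beyond_rotate hX hs q.rotate.rotate hce
    exact ⟨side q hab, side q.rotate hbc, side q.rotate.rotate hce,
      side q.rotate.rotate.rotate hea⟩
  refine ⟨hE.pos, hE.disj, ?_⟩
  obtain ⟨i, hi, hib⟩ := (hE.stuck 0).resolve_left (hlt 0).ne
  rcases hE.lt_or_lt hX hs (by decide : Quad 0 1 2 3) hi hib with h | h
  · exact Or.inl (wheel (by decide) (Or.inr ⟨i, hi, hib, h⟩))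
  · exact Or.inr (wheel (by decide) (Or.inr ⟨i, hi, hib, h⟩))

include hX hs in
theorem exists_isHole_ge (hne : s.Nonempty) (hA : Pos A) (hC : A ≤ C)
    (hd : ∀ i ∈ s, Disj A (X i)) : ∃ E, A ≤ E ∧ IsHole s X E := by
  obtain ⟨E, hAE, hEC, hEd, hEs⟩ := exists_le_stuck s X hC hd
  exact ⟨E, hAE, IsMaxEmpty.isHole hX hs ⟨hA.mono hAE, hEC, hEd, hEs⟩ hne⟩

end maximal

end Extents

/-! ### Uniqueness, persistence and counting of holes -/

namespace Extents

variable {a b c e : Fin 4} {A C E E' : Extents} {ι : Type*} {s : Finset ι} {X Y : ι → Extents}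

/-- Each arm covers a whole side of `E`, so a box overlapping `E` and sticking out through that side
would overlap the arm. -/
theorem Pinwheel.le (h : Pinwheel s X E a b c e) (q : Quad a b c e) (hX : ∀ i ∈ s, Pos (X i))
    (hAE : ¬ Disj A E) (hA : ∀ i ∈ s, X i ≠ A → Disj A (X i)) : A ≤ E := by
  have key : ∀ {a b c e : Fin 4}, Quad a b c e → Side s X E a b c e → A a ≤ E a := by
    intro a b c e q ⟨i, hi, h1, h2, h3⟩
    by_contra! hlt
    have hd := hAE
    rw [q.disj_iff] at hd
    push Not at hd
    have hne : X i ≠ A := by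
      rintro rfl
      linarith
    have hp := q.pos_iff.1 (hX i hi)
    rcases q.disj_iff.1 (hA i hi hne) with h4 | h4 | h4 | h4 <;> linarith
  rw [q.le_iff]
  exact ⟨key q h.1, key q.rotate h.2.1, key q.rotate.rotate h.2.2.1,
    key q.rotate.rotate.rotate h.2.2.2⟩

theorem IsHole.eq_of_not_disj (hX : ∀ i ∈ s, Pos (X i)) (h : IsHole s X E) (h' : IsHole s X E')
    (hd : ¬ Disj E E') : E = E' := by
  obtain ⟨a, b, c, e, q, hE⟩ := h.exists_pinwheel
  obtain ⟨a', b', c', e', q', hE'⟩ := h'.exists_pinwheel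
  exact le_antisymm (hE'.le q' hX hd fun i hi _ => h.disj i hi)
    (hE.le q hX (fun h => hd h.symm) fun i hi _ => h'.disj i hi)

theorem IsHole.lt (h : IsHole s X E) (hX : Packed s X C) (d : Fin 4) : E d < C d := by
  have key : ∀ {a b c e : Fin 4}, Quad a b c e → Side s X E a b c e → E a < C a := by
    intro a b c e q ⟨i, hi, h1, _⟩
    have hp := q.pos_iff.1 (hX.pos i hi)
    have hl := q.le_iff.1 (hX.le i hi)
    linarith
  have q := quad_self d
  rcases h.pinwheel_or q with h | h
  · exact key q h.1
  · exact key q.reflect h.1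

/-- Holes persist when the boxes around them expand. -/
theorem IsHole.expand (h : IsHole s X E) (hX : ∀ i ∈ s, Pos (X i)) (hXY : ∀ i ∈ s, X i ≤ Y i)
    (hY : ∀ i ∈ s, ∀ j ∈ s, i ≠ j → Disj (Y i) (Y j)) : IsHole s Y E := by
  -- At a corner of `E` the end of one arm abuts the flank of the next; disjointness of the expanded
  -- boxes keeps both in place.
  have corner : ∀ {a b c e : Fin 4}, Quad a b c e → ∀ i ∈ s, ∀ j ∈ s,
      X i c = - E a → X i e = E e → E b < X i b → X j e = - E b → X j a = E a → E c < X j c →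
      Y i c = - E a ∧ Y j a = E a := by
    intro a b c e q i hi j hj h1 h2 h3 h4 h5 h6
    have pE := q.pos_iff.1 h.pos
    have pi := q.pos_iff.1 (hX i hi)
    have pj := q.pos_iff.1 (hX j hj)
    have li := q.le_iff.1 (hXY i hi)
    have lj := q.le_iff.1 (hXY j hj)
    have hij : i ≠ j := by
      rintro rfl
      linarith
    rcases q.disj_iff.1 (hY i hi j hj hij) with h7 | h7 | h7 | h7
    · linarith
    · linarith
    · constructor <;> linarith
    · linarith
  have wheel : ∀ {a b c e : Fin 4}, Quad a b c e → Pinwheel s X E a b c e →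
      Pinwheel s Y E a b c e := by
    intro a b c e q ⟨⟨i, hi, i1, i2, i3⟩, ⟨j, hj, j1, j2, j3⟩, ⟨k, hk, k1, k2, k3⟩,
      ⟨l, hl, l1, l2, l3⟩⟩
    have hij := corner q i hi j hj i1 i2 i3 j1 j2 j3
    have hjk := corner q.rotate j hj k hk j1 j2 j3 k1 k2 k3
    have hkl := corner q.rotate.rotate k hk l hl k1 k2 k3 l1 l2 l3
    have hli := corner q.rotate.rotate.rotate l hl i hi l1 l2 l3 i1 i2 i3
    exact ⟨⟨i, hi, hij.1, hli.2, i3.trans_le (hXY i hi _)⟩,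
      ⟨j, hj, hjk.1, hij.2, j3.trans_le (hXY j hj _)⟩,
      ⟨k, hk, hkl.1, hjk.2, k3.trans_le (hXY k hk _)⟩,
      ⟨l, hl, hli.1, hkl.2, l3.trans_le (hXY l hl _)⟩⟩
  have hw : Pinwheel s Y E 0 1 2 3 ∨ Pinwheel s Y E 0 3 2 1 :=
    h.pinwheel.imp (wheel (by decide)) (wheel (by decide))
  refine ⟨h.pos, fun i hi => ?_, hw⟩
  by_contra hd
  -- An expanded box invading `E` would be trapped in `E`, although the original box is disjoint
  -- from `E`.
  have hle : Y i ≤ E := by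
    have hd' : ¬ Disj (Y i) E := fun h' => hd h'.symm
    have hYi : ∀ j ∈ s, Y j ≠ Y i → Disj (Y i) (Y j) := fun j hj hji =>
      hY i hi j hj fun hij => hji (hij ▸ rfl)
    have hpY : ∀ j ∈ s, Pos (Y j) := fun j hj => (hX j hj).mono (hXY j hj)
    rcases hw with hw | hw
    · exact hw.le (by decide) hpY hd' hYi
    · exact hw.le (by decide) hpY hd' hYi
  obtain ⟨d, hd⟩ := h.disj i hi
  have q := quad_self d
  have hp := q.pos_iff.1 (hX i hi)
  have hl := q.le_iff.1 ((hXY i hi).trans hle)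
  linarith

theorem Packed.subset (h : Packed s X C) {t : Finset ι} (hts : t ⊆ s) : Packed t X C :=
  ⟨fun i hi => h.pos i (hts hi), fun i hi => h.le i (hts hi),
    fun i hi j hj => h.disj i (hts hi) j (hts hj)⟩

/-- The corner of `X i` between the directions `a` and `b` is a corner of `E`, at which the side
of `X i` in direction `a` ends. -/
def CornerAt (s : Finset ι) (X : ι → Extents) (E : Extents) (a b c e : Fin 4) (i : ι) : Prop :=
  X i a = - E c ∧ X i b = E b ∧ ∃ j ∈ s, X j e = - E b ∧ X j a = E a ∧ E c < X j c

/-- The two alternatives are the two senses of the pinwheel. -/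
theorem IsHole.exists_cornerAt (h : IsHole s X E) (q : Quad a b c e) :
    ∃ i ∈ s, CornerAt s X E a b c e i ∨ CornerAt s X E b a e c i := by
  rcases h.pinwheel_or q with ⟨-, h2, ⟨i, hi, h3, h4, -⟩, -⟩ | ⟨h1, ⟨i, hi, h3, h4, -⟩, -⟩
  · exact ⟨i, hi, Or.inl ⟨h3, h4, h2⟩⟩
  · exact ⟨i, hi, Or.inr ⟨h3, h4, h1⟩⟩

theorem Quad.swap (q : Quad a b c e) : Quad b a e c := q.rotate.reflect

/-- With equal senses the holes share a corner and overlap. With opposite senses the arm `j` of one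
would overlap the other hole. -/
theorem IsHole.eq_of_cornerAt (hX : ∀ i ∈ s, Pos (X i)) (h : IsHole s X E) (h' : IsHole s X E')
    (q : Quad a b c e) {i : ι} (hi : CornerAt s X E a b c e i ∨ CornerAt s X E b a e c i)
    (hi' : CornerAt s X E' a b c e i ∨ CornerAt s X E' b a e c i) : E = E' := by
  have same : ∀ {a b c e : Fin 4}, Quad a b c e → CornerAt s X E a b c e i →
      CornerAt s X E' a b c e i → E = E' := by
    intro a b c e q h1 h2
    refine h.eq_of_not_disj hX h' fun hd => ?_
    have p := q.pos_iff.1 h.pos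
    have p' := q.pos_iff.1 h'.pos
    have e1 := h1.1
    have e2 := h1.2.1
    have e3 := h2.1
    have e4 := h2.2.1
    rcases q.disj_iff.1 hd with h3 | h3 | h3 | h3 <;> linarith
  have diff : ∀ {a b c e : Fin 4} {E E' : Extents}, Quad a b c e → IsHole s X E →
      IsHole s X E' → CornerAt s X E a b c e i → CornerAt s X E' b a e c i → False := by
    rintro a b c e E E' q h h' ⟨h1, h2, j, hj, h3, h4, h5⟩ ⟨h6, h7, -⟩
    have p := q.pos_iff.1 h.pos
    have p' := q.pos_iff.1 h'.pos
    have pj := q.pos_iff.1 (hX j hj)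
    rcases q.disj_iff.1 (h'.disj j hj) with h8 | h8 | h8 | h8 <;> linarith
  rcases hi with hi | hi <;> rcases hi' with hi' | hi'
  · exact same q hi hi'
  · exact (diff q h h' hi hi').elim
  · exact (diff q h' h hi' hi).elim
  · exact same q.swap hi hi'

theorem finite_setOf_isHole (hX : ∀ i ∈ s, Pos (X i)) : {E | IsHole s X E}.Finite := by
  have q : Quad 0 1 2 3 := by decide
  by_cases hne : Nonempty ι
  · choose! f hfs hf using fun E (hE : IsHole s X E) => hE.exists_cornerAt q
    refine Set.Finite.of_injOn (f := f) (t := s) (fun E hE => hfs E hE) ?_ s.finite_toSet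
    intro E hE E' hE' h
    exact IsHole.eq_of_cornerAt hX hE hE' q (hf E hE) (h ▸ hf E' hE')
  · refine Set.finite_empty.subset fun E hE => ?_
    obtain ⟨i, -⟩ := IsHole.exists_cornerAt hE q
    exact hne ⟨i⟩

open Classical in
/-- The boxes `X i` that touch the side of `C` in direction `d`. -/
noncomputable def touching (s : Finset ι) (X : ι → Extents) (C : Extents) (d : Fin 4) : Finset ι :=
  s.filter fun i => X i d = C d

theorem mem_touching {i : ι} {d : Fin 4} : i ∈ touching s X C d ↔ i ∈ s ∧ X i d = C d := by
  classical
  exact Finset.mem_filter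

theorem touching_subset {d : Fin 4} : touching s X C d ⊆ s := fun _ h => (mem_touching.1 h).1

/-- The holes correspond to boxes `X i` that touch neither of two adjacent sides of `C`. -/
theorem card_holes_add_le (hX : Packed s X C) (q : Quad a b c e) {H : Finset Extents}
    (hH : ∀ E ∈ H, IsHole s X E) :
    H.card + (touching s X C a).card + (touching s X C b).card ≤ s.card + 1 := by
  classical
  have hcard : H.card ≤ (s \ (touching s X C a ∪ touching s X C b)).card := by
    by_cases hne : Nonempty ι
    · choose! f hfs hf using fun E (hE : IsHole s X E) => hE.exists_cornerAt q
      refine Finset.card_le_card_of_injOn f (fun E hE => ?_) fun E hE E' hE' h =>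
        IsHole.eq_of_cornerAt hX.pos (hH E hE) (hH E' hE') q (hf E (hH E hE))
          (h ▸ hf E' (hH E' hE'))
      have hE := hH E hE
      rw [Finset.mem_coe, Finset.mem_sdiff, Finset.mem_union, mem_touching, mem_touching]
      refine ⟨hfs E hE, ?_⟩
      have la := hE.lt hX a
      have lb := hE.lt hX b
      have p := q.pos_iff.1 hE.pos
      rcases hf E hE with ⟨h1, h2, -⟩ | ⟨h1, h2, -⟩ <;> rintro (⟨-, h⟩ | ⟨-, h⟩) <;> linarith
    · rw [Finset.eq_empty_of_forall_notMem (s := H) fun E hE => ?_]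
      · simp
      · obtain ⟨i, -⟩ := (hH E hE).exists_cornerAt q
        exact hne ⟨i⟩
  -- Only a box in the common corner of the two sides touches both.
  have hinter : (touching s X C a ∩ touching s X C b).card ≤ 1 := by
    rw [Finset.card_le_one]
    intro i hi j hj
    rw [Finset.mem_inter, mem_touching, mem_touching] at hi hj
    by_contra hij
    have pi := q.pos_iff.1 (hX.pos i hi.1.1)
    have pj := q.pos_iff.1 (hX.pos j hj.1.1)
    rcases q.disj_iff.1 (hX.disj i hi.1.1 j hj.1.1 hij) with h | h | h | h <;>
      linarith [hi.1.2, hi.2.2, hj.1.2, hj.2.2]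
  have hu := Finset.card_union_add_card_inter (touching s X C a) (touching s X C b)
  have hsub : touching s X C a ∪ touching s X C b ⊆ s :=
    Finset.union_subset touching_subset touching_subset
  have := Finset.card_sdiff_add_card_eq_card hsub
  omega

/-- In an arrangement that can not be expanded, the boxes cover the sides of `C`. -/
theorem exists_touching (hX : Packed s X C) (hs : ∀ i ∈ s, ∀ d, Stuck s X C (X i) d)
    (hne : s.Nonempty) (q : Quad a b c e) {y : ℝ} (h1 : - C e ≤ y) (h2 : y < C b) :
    ∃ j ∈ touching s X C a, y < X j b ∧ - X j e ≤ y := by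
  have pC : Pos C := by
    obtain ⟨i, hi⟩ := hne
    exact (hX.pos i hi).mono (hX.le i hi)
  have pC' := q.pos_iff.1 pC
  have hev : ∀ u : ℝ, ∀ᶠ ε in nhdsWithin (0 : ℝ) (Ioi 0), 0 < u → ε < u := fun u => by
    by_cases hu : 0 < u
    · filter_upwards [Ioo_mem_nhdsGT hu] with ε hε _ using hε.2
    · exact Filter.Eventually.of_forall fun ε h => absurd h hu
  -- A box of size `ε` at an uncovered boundary point misses all boxes not touching side `a` and all
  -- those beginning beyond `y`. It would lie in a hole reaching the boundary.
  have hev1 := (Finset.eventually_all s).2 fun j _ => hev (C a - X j a)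
  have hev2 := (Finset.eventually_all s).2 fun j _ => hev (- X j e - y)
  obtain ⟨ε, e1, e2, e3, e4, e5⟩ := (hev1.and (hev2.and ((hev (C a + C c)).and
    ((hev (C b - y)).and (self_mem_nhdsWithin (s := Ioi (0 : ℝ)))))) ).exists
  have e3 := e3 pC'.1
  have e4 := e4 (by linarith)
  have e5 : 0 < ε := e5
  obtain ⟨-, nac, nae, nbc, nbe, nce⟩ := q.ne
  obtain ⟨A, Aa, Ab, Ac, Ae⟩ : ∃ A : Extents, A a = C a ∧ A b = y + ε ∧ A c = - C a + ε ∧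
      A e = - y := by
    refine ⟨fun d => if d = a then C a else if d = b then y + ε else if d = c then - C a + ε
      else - y, ?_, ?_, ?_, ?_⟩ <;> simp [nac.symm, nae.symm, nbc.symm, nbe.symm, nce.symm,
      q.ne.1.symm]
  have hAC : A ≤ C := by
    rw [q.le_iff]
    refine ⟨?_, ?_, ?_, ?_⟩ <;> linarith
  have hA : Pos A := by
    rw [q.pos_iff]
    constructor <;> linarith
  by_contra! hcon
  obtain ⟨E, hAE, hE⟩ := exists_isHole_ge hX hs hne hA hAC fun j hj => by
    by_contra hd
    rw [q.disj_iff] at hd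
    push Not at hd
    have h3 : X j a = C a := by
      by_contra h3
      have h4 := e1 j hj (sub_pos.2 (lt_of_le_of_ne (hX.le j hj a) h3))
      linarith
    have h4 := hcon j (mem_touching.2 ⟨hj, h3⟩) (by linarith)
    have h5 := e2 j hj (by linarith)
    linarith
  have := hE.lt hX a
  have := hAE a
  linarith

end Extents

/-! ### Peeling off the boxes along one side -/

namespace Extents

variable {a b c e : Fin 4} {A C E E' : Extents} {ι : Type*} {s : Finset ι} {X Y : ι → Extents}

open Classical in
/-- The boxes `X i` that do not touch the side of `C` in direction `d`. -/
noncomputable def nontouching (s : Finset ι) (X : ι → Extents) (C : Extents) (d : Fin 4) :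
    Finset ι :=
  s.filter fun i => ¬ X i d = C d

theorem mem_nontouching {i : ι} {d : Fin 4} : i ∈ nontouching s X C d ↔ i ∈ s ∧ X i d ≠ C d := by
  classical
  exact Finset.mem_filter

theorem nontouching_subset {d : Fin 4} : nontouching s X C d ⊆ s :=
  fun _ h => (mem_nontouching.1 h).1

theorem card_touching_add_card_nontouching (d : Fin 4) :
    (touching s X C d).card + (nontouching s X C d).card = s.card := by
  classical
  exact Finset.card_filter_add_card_filter_not _

/-- The box `X i` bounds `E` in direction `a` or `e`, with one end at `E`. -/
def Supports (X : ι → Extents) (E : Extents) (a b c e : Fin 4) (i : ι) : Prop :=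
  X i c = - E a ∧ X i e = E e ∨ X i b = - E e ∧ X i c = E c

/-- The arms on sides `b` and `c` end before the side `a` of `C`, so only those on `a` and `e` can
be removed. -/
theorem Pinwheel.exists_supports (hX : Packed s X C) (hE : IsHole s X E) (q : Quad a b c e)
    (hp : Pinwheel s X E a b c e)
    (hn : ¬ Pinwheel (nontouching s X C a) X E a b c e) :
    ∃ i ∈ touching s X C a, Supports X E a b c e i := by
  obtain ⟨⟨i, hi, i1, i2, i3⟩, ⟨j, hj, j1, j2, j3⟩, ⟨k, hk, k1, k2, k3⟩, ⟨l, hl, l1, l2, l3⟩⟩ := hp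
  have hlt := hE.lt hX a
  have pE := q.pos_iff.1 hE.pos
  by_cases hia : X i a = C a
  · exact ⟨i, mem_touching.2 ⟨hi, hia⟩, Or.inl ⟨i1, i2⟩⟩
  by_cases hla : X l a = C a
  · exact ⟨l, mem_touching.2 ⟨hl, hla⟩, Or.inr ⟨l1, l2⟩⟩
  refine (hn ⟨⟨i, mem_nontouching.2 ⟨hi, hia⟩, i1, i2, i3⟩,
    ⟨j, mem_nontouching.2 ⟨hj, fun h => ?_⟩, j1, j2, j3⟩,
    ⟨k, mem_nontouching.2 ⟨hk, fun h => ?_⟩, k1, k2, k3⟩,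
    ⟨l, mem_nontouching.2 ⟨hl, hla⟩, l1, l2, l3⟩⟩).elim <;> linarith

/-- Edges of `E` and `X i` form an unbroken wall from the hole to the side `a` of `C`; a box
crossing its line must lie behind the hole. -/
theorem Supports.le (hX : Packed s X C) (hE : IsHole s X E) (q : Quad a b c e) {i : ι}
    (hi : i ∈ touching s X C a) (h : Supports X E a b c e i) {j : ι} (hj : j ∈ s)
    (h1 : E e < X j e) (h2 : - E e < X j b) : X j a ≤ - E c := by
  obtain ⟨his, hia⟩ := mem_touching.1 hi
  have pE := q.pos_iff.1 hE.pos
  have pi := q.pos_iff.1 (hX.pos i his)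
  have pj := q.pos_iff.1 (hX.pos j hj)
  have lj := hX.le j hj a
  have hdj := q.disj_iff.1 (hE.disj j hj)
  have hij : i ≠ j := by
    rintro rfl
    rcases h with h | h <;> linarith
  have hdi := q.disj_iff.1 (hX.disj i his j hj hij)
  rcases h with ⟨h3, h4⟩ | ⟨h3, h4⟩
  · rcases hdj with h5 | h5 | h5 | h5
    · rcases hdi with h6 | h6 | h6 | h6 <;> linarith
    all_goals linarith
  · rcases hdi with h6 | h6 | h6 | h6 <;> linarith

/-- The touching boxes cover side `a` of `C`, so the neighbour of `X i` begins exactly where the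
wall arrives. -/
theorem Supports.exists_eq (hX : Packed s X C) (hs : ∀ i ∈ s, ∀ d, Stuck s X C (X i) d)
    (hE : IsHole s X E) (q : Quad a b c e) {i : ι}
    (hi : i ∈ touching s X C a) (h : Supports X E a b c e i) :
    (∃ j ∈ touching s X C a, X j b = - E e) ∧ ∃ j ∈ touching s X C a, X j e = E e := by
  obtain ⟨his, hia⟩ := mem_touching.1 hi
  have pE := q.pos_iff.1 hE.pos
  have lb := hE.lt hX b
  have le := hE.lt hX e
  have next : ∀ {b c e : Fin 4}, Quad a b c e → X i b < C b →
      ∃ j ∈ touching s X C a, X j e = - X i b := by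
    intro b c e q hlt
    have pi := q.pos_iff.1 (hX.pos i his)
    have li := q.le_iff.1 (hX.le i his)
    obtain ⟨j, hj, h1, h2⟩ := exists_touching hX hs ⟨i, his⟩ q (y := X i b) (by linarith) hlt
    refine ⟨j, hj, ?_⟩
    obtain ⟨hjs, hja⟩ := mem_touching.1 hj
    have pj := q.pos_iff.1 (hX.pos j hjs)
    have hij : i ≠ j := by
      rintro rfl
      linarith
    rcases q.disj_iff.1 (hX.disj i his j hjs hij) with h6 | h6 | h6 | h6 <;> linarith
  rcases h with ⟨-, h3⟩ | ⟨h3, -⟩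
  · obtain ⟨j, hj, h4⟩ := next q.reflect (by linarith)
    exact ⟨⟨j, hj, by linarith⟩, ⟨i, hi, h3⟩⟩
  · obtain ⟨j, hj, h4⟩ := next q (by linarith)
    exact ⟨⟨i, hi, h3⟩, ⟨j, hj, by linarith⟩⟩

/-- A wall of the hole `E` lies on the line at height `h` (measured in direction `b`), begins at
`E`, and reaches the side `a` of a box containing all `X i`. -/
def Reaches (s : Finset ι) (X : ι → Extents) (E : Extents) (a b c e : Fin 4) (h : ℝ) : Prop :=
  (h = - E e ∧ Pinwheel s X E a b c e ∨ h = E b ∧ Pinwheel s X E a e c b) ∧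
    ∀ j ∈ s, - X j e < h → h < X j b → X j a ≤ - E c

theorem IsHole.exists_reaches (hX : Packed s X C) (hs : ∀ i ∈ s, ∀ d, Stuck s X C (X i) d)
    (hE : IsHole s X E) (q : Quad a b c e) (hn : ¬ IsHole (nontouching s X C a) X E) :
    ∃ i ∈ touching s X C a, X i b ≠ C b ∧ Reaches s X E a b c e (X i b) := by
  have hn' : ∀ {a' b' c' e' : Fin 4}, Quad a' b' c' e' →
      ¬ Pinwheel (nontouching s X C a) X E a' b' c' e' := by
    intro a' b' c' e' q' h
    refine hn ⟨hE.pos, fun i hi => hE.disj i (nontouching_subset hi), ?_⟩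
    clear hn
    obtain ⟨rfl, rfl, rfl | rfl⟩ := q' <;> revert h <;> unfold Pinwheel <;>
      rcases (by decide : Quad 0 1 2 3).eq_or a' with rfl | rfl | rfl | rfl <;>
      simp only [Fin.reduceAdd] <;> tauto
  have pE := q.pos_iff.1 hE.pos
  have lb := hE.lt hX b
  rcases hE.pinwheel_or q with hp | hp
  · obtain ⟨i, hi, hsup⟩ := hp.exists_supports hX hE q (hn' q)
    obtain ⟨k, hk, hke⟩ := (hsup.exists_eq hX hs hE q hi).1
    refine ⟨k, hk, by linarith, Or.inl ⟨hke, hp⟩, fun j hj h1 h2 => ?_⟩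
    exact hsup.le hX hE q hi hj (by linarith) (by linarith)
  · obtain ⟨i, hi, hsup⟩ := hp.exists_supports hX hE q.reflect (hn' q.reflect)
    obtain ⟨k, hk, hke⟩ := (hsup.exists_eq hX hs hE q.reflect hi).2
    refine ⟨k, hk, by linarith, Or.inr ⟨hke, hp⟩, fun j hj h1 h2 => ?_⟩
    exact hsup.le hX hE q.reflect hi hj (by linarith) (by linarith)

/-- The arm of `E'` on side `c` crosses the line at height `h`, so it lies behind `E` too. -/
theorem Reaches.le {h : ℝ} (hE : Reaches s X E a b c e h) (hE' : Reaches s X E' a b c e h)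
    (pE' : Pos E') (q : Quad a b c e) : E c ≤ E' c := by
  have p := q.pos_iff.1 pE'
  rcases hE'.1 with ⟨rfl, -, -, ⟨j, hj, h1, h2, h3⟩, -⟩ | ⟨rfl, -, -, ⟨j, hj, h1, h2, h3⟩, -⟩
  · have := hE.2 j hj (by linarith) (by linarith)
    linarith
  · have := hE.2 j hj (by linarith) (by linarith)
    linarith

/-- Both walls begin at the same point by `Reaches.le`. Holes on the same side of the line overlap;
on opposite sides, an arm of one would overlap the other. -/
theorem Reaches.eq (hX : ∀ i ∈ s, Pos (X i)) (q : Quad a b c e) (hE : IsHole s X E)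
    (hE' : IsHole s X E') {h : ℝ} (hr : Reaches s X E a b c e h)
    (hr' : Reaches s X E' a b c e h) : E = E' := by
  have hc : E c = E' c := le_antisymm (hr.le hr' hE'.pos q) (hr'.le hr hE.pos q)
  have p := q.pos_iff.1 hE.pos
  have p' := q.pos_iff.1 hE'.pos
  have diff : ∀ {E E' : Extents}, IsHole s X E → IsHole s X E' → E c = E' c →
      - E e = E' b → Pinwheel s X E a b c e → False := by
    rintro E E' hE hE' hc heb ⟨-, -, -, ⟨j, hj, h1, h2, h3⟩⟩
    have p := q.pos_iff.1 hE.pos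
    have p' := q.pos_iff.1 hE'.pos
    have pj := q.pos_iff.1 (hX j hj)
    rcases q.disj_iff.1 (hE'.disj j hj) with h6 | h6 | h6 | h6 <;> linarith
  rcases hr.1 with ⟨h1, h2⟩ | ⟨h1, h2⟩ <;> rcases hr'.1 with ⟨h3, h4⟩ | ⟨h3, h4⟩
  · refine hE.eq_of_not_disj hX hE' fun hd => ?_
    rcases q.disj_iff.1 hd with h6 | h6 | h6 | h6 <;> linarith
  · exact (diff hE hE' hc (by linarith) h2).elim
  · exact (diff hE' hE hc.symm (by linarith) h4).elim
  · refine hE.eq_of_not_disj hX hE' fun hd => ?_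
    rcases q.disj_iff.1 hd with h6 | h6 | h6 | h6 <;> linarith

/-- Removing the boxes that touch one side of `C` destroys fewer holes than boxes. -/
theorem exists_holes_nontouching (hX : Packed s X C) (hs : ∀ i ∈ s, ∀ d, Stuck s X C (X i) d)
    (hne : s.Nonempty) (a : Fin 4) {H : Finset Extents} (hH : ∀ E ∈ H, IsHole s X E) :
    ∃ H' : Finset Extents, (∀ E ∈ H', IsHole (nontouching s X C a) X E) ∧
      H.card + 1 ≤ H'.card + (touching s X C a).card := by
  classical
  have q := quad_self a
  set b := a + 1
  set c := a + 2
  set e := a + 3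
  have pC : Pos C := by
    obtain ⟨i, hi⟩ := hne
    exact (hX.pos i hi).mono (hX.le i hi)
  have pC' := q.pos_iff.1 pC
  refine ⟨H.filter fun E => IsHole (nontouching s X C a) X E,
    fun E hE => (Finset.mem_filter.1 hE).2, ?_⟩
  have hsplit := Finset.card_filter_add_card_filter_not (s := H)
    (fun E => IsHole (nontouching s X C a) X E)
  set R := H.filter fun E => ¬ IsHole (nontouching s X C a) X E with hR
  set V := (touching s X C a).image fun i => X i b with hV
  have hCV : C b ∈ V := by
    obtain ⟨j, hj, -, h2⟩ := exists_touching hX hs hne q.reflect (y := - C b) le_rfl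
      (by linarith)
    refine Finset.mem_image.2 ⟨j, hj, ?_⟩
    have := hX.le j (touching_subset hj) b
    linarith
  -- `C b` is an end of a touching box but never the height of a wall; this saves one hole.
  have hcardV : (V.erase (C b)).card + 1 ≤ (touching s X C a).card := by
    rw [Finset.card_erase_add_one hCV]
    exact Finset.card_image_le
  have hex : ∀ E ∈ R, ∃ h ∈ V.erase (C b), Reaches s X E a b c e h := by
    intro E hE
    obtain ⟨hE1, hE2⟩ := Finset.mem_filter.1 hE
    obtain ⟨i, hi, h1, h2⟩ := (hH E hE1).exists_reaches hX hs q hE2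
    exact ⟨X i b, Finset.mem_erase.2 ⟨h1, Finset.mem_image_of_mem _ hi⟩, h2⟩
  choose! f hf hfr using hex
  have hcardR : R.card ≤ (V.erase (C b)).card := by
    refine Finset.card_le_card_of_injOn f hf fun E hE E' hE' h => ?_
    have h1 := Finset.mem_filter.1 (Finset.mem_coe.1 hE)
    have h2 := Finset.mem_filter.1 (Finset.mem_coe.1 hE')
    exact Reaches.eq hX.pos q (hH E h1.1) (hH E' h2.1) (hfr E hE) (h ▸ hfr E' hE')
  omega

/-- The number of holes in an arrangement of `m` boxes is at most `m - ⌈2 * √m - 1⌉`. -/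
theorem exists_card_holes_add_eq (hX : Packed s X C) {H : Finset Extents}
    (hH : ∀ E ∈ H, IsHole s X E) :
    ∃ D, H.card + D = s.card ∧ 4 * s.card ≤ (D + 1) ^ 2 := by
  classical
  induction hm : s.card using Nat.strong_induction_on generalizing s X H with
  | _ m ih =>
  rcases s.eq_empty_or_nonempty with rfl | hne
  · have : H = ∅ := by
      refine Finset.eq_empty_of_forall_notMem fun E hE => ?_
      obtain ⟨i, hi, -⟩ := (hH E hE).exists_cornerAt (quad_self 0)
      exact Finset.notMem_empty i hi
    subst this
    rw [Finset.card_empty] at hm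
    subst hm
    exact ⟨0, rfl, by norm_num⟩
  obtain ⟨Y, hXY, hY, hYs⟩ := hX.exists_stuck
  have hHY : ∀ E ∈ H, IsHole s Y E := fun E hE => (hH E hE).expand hX.pos hXY hY.disj
  have hcount := card_holes_add_le hY (quad_self 0) hHY
  have hpos : ∀ d, 0 < (touching s Y C d).card := by
    intro d
    have q := quad_self d
    have pC : Pos C := by
      obtain ⟨i, hi⟩ := hne
      exact (hY.pos i hi).mono (hY.le i hi)
    obtain ⟨j, hj, -⟩ := exists_touching hY hYs hne q (y := - C (d + 3)) le_rfl
      (by linarith [(q.pos_iff.1 pC).2])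
    exact Finset.card_pos.2 ⟨j, hj⟩
  have peel : ∀ d, H.card < m → 2 * (touching s Y C d).card ≤ m - H.card + 1 →
      4 * m ≤ (m - H.card + 1) ^ 2 := by
    intro d hlt hk
    obtain ⟨H', hH', hcard⟩ := exists_holes_nontouching hY hYs hne d hHY
    have hsum := card_touching_add_card_nontouching (s := s) (X := Y) (C := C) d
    have := hpos d
    obtain ⟨D', h1, h2⟩ := ih _ (by omega) (hY.subset nontouching_subset) hH' rfl
    obtain ⟨D, hD⟩ := Nat.exists_eq_add_of_lt hlt
    have hD' : m - H.card = D + 1 := by omega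
    rw [hD'] at hk ⊢
    have h3 : D' ≤ D := by omega
    have h4 : (D' + 1) ^ 2 ≤ (D + 1) ^ 2 := Nat.pow_le_pow_left (by omega) 2
    -- Here `D` is one less than `m - H.card`. The extra 1 is excluded below because no square is 3
    -- modulo 4.
    have h5 : 4 * m ≤ (D + 1 + 1) ^ 2 + 1 := by
      have : (D + 1 + 1) ^ 2 = (D + 1) ^ 2 + 2 * (D + 1) + 1 := by ring
      omega
    by_contra! h6
    have h7 : 4 * m = (D + 1 + 1) ^ 2 + 1 := by omega
    rcases Nat.even_or_odd' (D + 1 + 1) with ⟨t, ht | ht⟩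
    · rw [ht] at h7
      have : (2 * t) ^ 2 = 4 * t ^ 2 := by ring
      omega
    · rw [ht] at h7
      have : (2 * t + 1) ^ 2 = 4 * (t ^ 2 + t) + 1 := by ring
      omega
  have h0 := hpos 0
  have h1 := hpos (0 + 1)
  have hlt : H.card < m := by omega
  refine ⟨m - H.card, by omega, ?_⟩
  rcases le_total (touching s Y C 0).card (touching s Y C (0 + 1)).card with h | h
  · exact peel 0 hlt (by omega)
  · exact peel (0 + 1) hlt (by omega)

end Extents

/-! ### Back to rectangles: the upper bound -/

namespace AxisRect

theorem interior_toSet (R : AxisRect) :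
    interior R.toSet = Ioo R.left R.right ×ˢ Ioo R.bottom R.top := by
  rw [toSet, interior_prod_eq, interior_Icc, interior_Icc]

theorem interiorDisjoint_iff {R S : AxisRect} : R.InteriorDisjoint S ↔
    R.right ≤ S.left ∨ R.top ≤ S.bottom ∨ S.right ≤ R.left ∨ S.top ≤ R.bottom := by
  have h1 := R.left_lt_right
  have h2 := R.bottom_lt_top
  have h3 := S.left_lt_right
  have h4 := S.bottom_lt_top
  rw [InteriorDisjoint, interior_toSet, interior_toSet, disjoint_prod, Ioo_disjoint_Ioo,
    Ioo_disjoint_Ioo, min_le_iff, le_max_iff, le_max_iff, min_le_iff, le_max_iff, le_max_iff]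
  constructor
  · rintro (((h | h) | (h | h)) | ((h | h) | (h | h))) <;> first | (exfalso; linarith) | tauto
  · tauto

theorem toSet_subset_iff {R S : AxisRect} : R.toSet ⊆ S.toSet ↔
    R.right ≤ S.right ∧ R.top ≤ S.top ∧ S.left ≤ R.left ∧ S.bottom ≤ R.bottom := by
  have h1 := R.left_lt_right
  have h2 := R.bottom_lt_top
  rw [toSet, toSet, prod_subset_prod_iff, Icc_subset_Icc_iff h1.le, Icc_subset_Icc_iff h2.le,
    Icc_eq_empty_iff, Icc_eq_empty_iff]
  have h3 := h1.le
  have h4 := h2.le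
  tauto

/-- The coordinates of the sides, with signs such that they grow with the rectangle. -/
def extents (R : AxisRect) : Extents := ![R.right, R.top, - R.left, - R.bottom]

/-- The rectangle with the given extents. -/
def ofExtents (A : Extents) (h : A.Pos) : AxisRect where
  left := - A 2
  right := A 0
  bottom := - A 3
  top := A 1
  left_lt_right := by have := h 0; simp only [zero_add] at this; linarith
  bottom_lt_top := by have := h 1; simp only [Fin.reduceAdd] at this; linarith

theorem pos_extents (R : AxisRect) : R.extents.Pos := by
  rw [(by decide : Extents.Quad 0 1 2 3).pos_iff]
  have h1 := R.left_lt_right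
  have h2 := R.bottom_lt_top
  simp only [extents]
  constructor
  · simpa using h1
  · simpa using h2

theorem extents_ofExtents (A : Extents) (h : A.Pos) : (ofExtents A h).extents = A := by
  funext d
  fin_cases d <;> simp [extents, ofExtents]

theorem disj_extents_iff {R S : AxisRect} :
    R.extents.Disj S.extents ↔ R.InteriorDisjoint S := by
  rw [(by decide : Extents.Quad 0 1 2 3).disj_iff, interiorDisjoint_iff]
  simp [extents, neg_add_eq_sub]

theorem extents_le_iff {R S : AxisRect} :
    R.extents ≤ S.extents ↔ R.toSet ⊆ S.toSet := by
  rw [(by decide : Extents.Quad 0 1 2 3).le_iff, toSet_subset_iff]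
  simp [extents]

/-- The point `p`, as a degenerate rectangle. -/
def pointExtents (p : ℝ × ℝ) : Extents := ![p.1, p.2, - p.1, - p.2]

theorem pointExtents_le_iff {R : AxisRect} {p : ℝ × ℝ} :
    pointExtents p ≤ R.extents ↔ p ∈ R.toSet := by
  rw [(by decide : Extents.Quad 0 1 2 3).le_iff, toSet, mem_prod, mem_Icc, mem_Icc]
  simp [extents, pointExtents]
  tauto

theorem pointExtents_add_two (p : ℝ × ℝ) (d : Fin 4) :
    pointExtents p d + pointExtents p (d + 2) = 0 := by
  fin_cases d <;> simp [pointExtents]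

end AxisRect

namespace Extents

/-- A point that is not covered by the boxes `X i` has a neighbourhood in `C` that is not. -/
theorem exists_ge_disj {ι : Type*} {s : Finset ι} {X : ι → Extents} {C A : Extents}
    (hC : C.Pos) (hAC : A ≤ C) (hA : ∀ d, A d + A (d + 2) = 0) (hX : ∀ i ∈ s, ¬ A ≤ X i) :
    ∃ B, A ≤ B ∧ B ≤ C ∧ B.Pos ∧ ∀ i ∈ s, Disj B (X i) := by
  have hex : ∀ i ∈ s, ∃ d, X i d < A d := fun i hi => by
    have := hX i hi
    rw [Pi.le_def] at this
    push Not at this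
    exact this
  choose! f hf using hex
  have hev : ∀ᶠ ε in nhdsWithin (0 : ℝ) (Ioi 0), ∀ i ∈ s, ε < A (f i) - X i (f i) :=
    (Finset.eventually_all s).2 fun i hi => by
      filter_upwards [Ioo_mem_nhdsGT (sub_pos.2 (hf i hi))] with ε hε using hε.2
  obtain ⟨ε, hε, hε0⟩ := (hev.and (self_mem_nhdsWithin (s := Ioi (0 : ℝ)))).exists
  have hε0 : 0 < ε := hε0
  refine ⟨fun d => min (C d) (A d + ε), fun d => le_min (hAC d) (by linarith),
    fun d => min_le_left _ _, fun d => ?_, fun i hi => ?_⟩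
  · have h1 := hA d
    have h2 := hC d
    have h3 := hAC d
    have h4 := hAC (d + 2)
    change 0 < min (C d) (A d + ε) + min (C (d + 2)) (A (d + 2) + ε)
    rcases min_cases (C d) (A d + ε) with ⟨h5, -⟩ | ⟨h5, -⟩ <;>
      rcases min_cases (C (d + 2)) (A (d + 2) + ε) with ⟨h6, -⟩ | ⟨h6, -⟩ <;>
      rw [h5, h6] <;> linarith
  · have h1 := hε i hi
    have h2 := hA (f i)
    have q := quad_self (f i)
    refine ⟨f i + 2, ?_⟩
    rw [q.add_two.2.2.1]
    have h3 := min_le_right (C (f i + 2)) (A (f i + 2) + ε)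
    linarith

end Extents

namespace AxisRect

open Extents

theorem hasPartitionWithBlanks_one_of_isEmpty (C : AxisRect) (Z : Fin 0 → AxisRect) :
    C.HasPartitionWithBlanks Z 1 := by
  refine ⟨fun _ => C, ⟨?_, fun i j hij => ?_⟩, fun i => i.elim0⟩
  · exact iUnion_const (ι := Fin 1) _
  · exact (hij (Subsingleton.elim (α := Fin 1) i j)).elim

theorem ceil_le_of_four_mul_le {m D : ℕ} (h : 4 * m ≤ (D + 1) ^ 2) :
    ⌈2 * √(m : ℝ) - 1⌉ ≤ (D : ℤ) := by
  rw [Int.ceil_le, Int.cast_natCast, sub_le_iff_le_add, ← le_div_iff₀' two_pos]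
  refine Real.sqrt_le_iff.2 ⟨by positivity, ?_⟩
  have : (4 * m : ℝ) ≤ (D + 1) ^ 2 := by exact_mod_cast h
  rw [div_pow]
  linarith

theorem exists_hasPartitionWithBlanks {m : ℕ} (C : AxisRect) (Z : Fin m → AxisRect)
    (hZC : ∀ i, (Z i).toSet ⊆ C.toSet)
    (hZ : Pairwise fun i j => (Z i).InteriorDisjoint (Z j)) :
    ∃ b : ℕ, (b : ℤ) ≤ (m : ℤ) - ⌈2 * √(m : ℝ) - 1⌉ ∧ C.HasPartitionWithBlanks Z b := by
  rcases Nat.eq_zero_or_pos m with rfl | hm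
  -- For `m = 0` the bound is 1, as `⌈2 * √0 - 1⌉ = -1`; the cake itself is the blank.
  · exact ⟨1, by simp [Int.ceil_neg], hasPartitionWithBlanks_one_of_isEmpty C Z⟩
  have hX : Packed Finset.univ (fun i => (Z i).extents) C.extents :=
    ⟨fun i _ => (Z i).pos_extents, fun i _ => extents_le_iff.2 (hZC i),
      fun i _ j _ hij => disj_extents_iff.2 (hZ hij)⟩
  obtain ⟨Y, hZY, hY, hYs⟩ := hX.exists_stuck
  have hne : (Finset.univ : Finset (Fin m)).Nonempty := ⟨⟨0, hm⟩, Finset.mem_univ _⟩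
  have hfin := finite_setOf_isHole (s := Finset.univ) (X := Y) hY.pos
  set H := hfin.toFinset with hH
  have hHmem : ∀ E, E ∈ H ↔ IsHole Finset.univ Y E := fun E => hfin.mem_toFinset
  obtain ⟨D, hD, hmD⟩ := exists_card_holes_add_eq hY (H := H) fun E hE => (hHmem E).1 hE
  rw [Finset.card_univ, Fintype.card_fin] at hD hmD
  refine ⟨H.card, ?_, ?_⟩
  · have := ceil_le_of_four_mul_le hmD
    have : (H.card : ℤ) + D = m := by exact_mod_cast hD
    linarith
  let top (i : Fin m) : AxisRect := ofExtents (Y i) (hY.pos i (Finset.mem_univ i))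
  let ext (j : Fin H.card) : Extents := H.equivFin.symm j
  have hext : ∀ j, IsHole Finset.univ Y (ext j) := fun j =>
    (hHmem _).1 (H.equivFin.symm j).2
  let blank (j : Fin H.card) : AxisRect := ofExtents (ext j) (hext j).pos
  have htop : ∀ i, (top i).extents = Y i := fun i => extents_ofExtents _ _
  have hblank : ∀ j, (blank j).extents = ext j := fun j => extents_ofExtents _ _
  refine ⟨Fin.append top blank, ⟨?_, ?_⟩, fun i => ?_⟩
  · refine Subset.antisymm (iUnion_subset fun k => ?_) fun p hp => ?_
    · refine Fin.addCases (fun i => ?_) (fun j => ?_) k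
      · rw [Fin.append_left, ← extents_le_iff, htop]
        exact hY.le i (Finset.mem_univ i)
      · rw [Fin.append_right, ← extents_le_iff, hblank]
        exact fun d => ((hext j).lt hY d).le
    · by_cases hcov : ∃ i, p ∈ (top i).toSet
      · obtain ⟨i, hi⟩ := hcov
        exact mem_iUnion.2 ⟨Fin.castAdd _ i, by rwa [Fin.append_left]⟩
      · push Not at hcov
        obtain ⟨B, hpB, hBC, hB, hBd⟩ := exists_ge_disj (s := Finset.univ) (X := Y)
          C.pos_extents (pointExtents_le_iff.2 hp) (pointExtents_add_two p) fun i _ h =>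
          hcov i (by rwa [← pointExtents_le_iff, htop])
        obtain ⟨E, hBE, hE⟩ := exists_isHole_ge hY hYs hne hB hBC hBd
        refine mem_iUnion.2 ⟨Fin.natAdd _ (H.equivFin ⟨E, (hHmem E).2 hE⟩), ?_⟩
        rw [Fin.append_right, ← pointExtents_le_iff, hblank]
        refine (hpB.trans hBE).trans_eq ?_
        simp only [ext, Equiv.symm_apply_apply]
  · intro k l
    refine Fin.addCases (fun i => ?_) (fun i => ?_) k <;>
      refine Fin.addCases (fun j => ?_) (fun j => ?_) l <;> intro hne'
    · rw [Fin.append_left, Fin.append_left, ← disj_extents_iff, htop, htop]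
      exact hY.disj i (Finset.mem_univ i) j (Finset.mem_univ j) fun h => hne' (h ▸ rfl)
    · rw [Fin.append_left, Fin.append_right, ← disj_extents_iff, htop, hblank]
      exact ((hext j).disj i (Finset.mem_univ i)).symm
    · rw [Fin.append_left, Fin.append_right, ← disj_extents_iff, htop, hblank]
      exact (hext i).disj j (Finset.mem_univ j)
    · rw [Fin.append_right, Fin.append_right, ← disj_extents_iff, hblank, hblank]
      by_contra hd
      have h1 := (hext i).eq_of_not_disj hY.pos (hext j) hd
      have h2 : i = j := H.equivFin.symm.injective (Subtype.ext h1)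
      exact hne' (h2 ▸ rfl)
  · rw [Fin.append_left, ← extents_le_iff, htop]
    exact hZY i (Finset.mem_univ i)

end AxisRect

/-! ### The basket weave -/

namespace AxisRect

theorem IsPartition.eq_of_mem {C : AxisRect} {n : ℕ} {P : Fin n → AxisRect}
    (hP : C.IsPartition P) {k l : Fin n} {p : ℝ × ℝ} (hk : p ∈ (P k).toSet)
    (hl : p ∈ interior (P l).toSet) : k = l := by
  by_contra hkl
  rw [interior_toSet, mem_prod, mem_Ioo, mem_Ioo] at hl
  rw [toSet, mem_prod, mem_Icc, mem_Icc] at hk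
  rcases interiorDisjoint_iff.1 (hP.pairwise_interiorDisjoint hkl) with h | h | h | h <;> linarith

theorem mem_toSet_of_le {R : AxisRect} {p q : ℝ × ℝ} (hp : p ∈ R.toSet) (hq : q ∈ R.toSet)
    {x y : ℝ} (hx : p.1 ≤ x ∧ x ≤ q.1 ∨ q.1 ≤ x ∧ x ≤ p.1)
    (hy : p.2 ≤ y ∧ y ≤ q.2 ∨ q.2 ≤ y ∧ y ≤ p.2) : (x, y) ∈ R.toSet := by
  rw [toSet, mem_prod, mem_Icc, mem_Icc] at *
  refine ⟨?_, ?_⟩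
  · rcases hx with hx | hx <;> constructor <;> linarith
  · rcases hy with hy | hy <;> constructor <;> linarith

theorem mk_mem_toSet {R : AxisRect} {p q : ℝ × ℝ} (hp : p ∈ R.toSet) (hq : q ∈ R.toSet) :
    (p.1, q.2) ∈ R.toSet :=
  ⟨hp.1, hq.2⟩

/-- The rectangle with centre `(i, j)` in a basket weave pattern: the long side is horizontal if
`i + j` is even and vertical otherwise. -/
noncomputable def weave (i j : ℕ) : AxisRect where
  -- Since `7 / 10 > 1 / 2`, rectangles reach past the gap points beside them; since `7 / 10 + 1 / 5
  -- < 1`, neighbours stay apart.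
  left := i - if Even (i + j) then 7 / 10 else 1 / 5
  right := i + if Even (i + j) then 7 / 10 else 1 / 5
  bottom := j - if Even (i + j) then 1 / 5 else 7 / 10
  top := j + if Even (i + j) then 1 / 5 else 7 / 10
  left_lt_right := by split_ifs <;> linarith
  bottom_lt_top := by split_ifs <;> linarith

theorem mem_interior_weave_of_even {i j : ℕ} (h : Even (i + j)) {x y : ℝ} (h1 : i - 7 / 10 < x)
    (h2 : x < i + 7 / 10) (h3 : j - 1 / 5 < y) (h4 : y < j + 1 / 5) :
    (x, y) ∈ interior (weave i j).toSet := by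
  rw [interior_toSet, mem_prod, mem_Ioo, mem_Ioo]
  simp only [weave, if_pos h]
  exact ⟨⟨h1, h2⟩, h3, h4⟩

theorem mem_interior_weave_of_not_even {i j : ℕ} (h : ¬ Even (i + j)) {x y : ℝ}
    (h1 : i - 1 / 5 < x) (h2 : x < i + 1 / 5) (h3 : j - 7 / 10 < y) (h4 : y < j + 7 / 10) :
    (x, y) ∈ interior (weave i j).toSet := by
  rw [interior_toSet, mem_prod, mem_Ioo, mem_Ioo]
  simp only [weave, if_neg h]
  exact ⟨⟨h1, h2⟩, h3, h4⟩

theorem center_mem_interior_weave (i j : ℕ) : ((i : ℝ), (j : ℝ)) ∈ interior (weave i j).toSet := by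
  by_cases h : Even (i + j)
  · refine mem_interior_weave_of_even h ?_ ?_ ?_ ?_ <;> linarith
  · refine mem_interior_weave_of_not_even h ?_ ?_ ?_ ?_ <;> linarith

theorem eq_of_mem_weave {i j i' j' : ℕ} {p : ℝ × ℝ} (h : p ∈ (weave i j).toSet)
    (h' : p ∈ (weave i' j').toSet) : i = i' ∧ j = j' := by
  have near : ∀ {u v : ℕ} {r : ℝ} (n : ℕ), r < n → (u : ℝ) - v ≤ r → u < v + n := by
    intro u v r n hr huv
    have : (u : ℝ) < v + n := by linarith
    exact_mod_cast this
  rw [toSet, mem_prod, mem_Icc, mem_Icc] at h h'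
  simp only [weave] at h h'
  obtain ⟨⟨h1, h2⟩, h3, h4⟩ := h
  obtain ⟨⟨h5, h6⟩, h7, h8⟩ := h'
  by_cases e : Even (i + j) <;> by_cases e' : Even (i' + j')
  · rw [if_pos e] at h1 h2 h3 h4
    rw [if_pos e'] at h5 h6 h7 h8
    have a1 := near (u := i) (v := i') (r := 7 / 5) 2 (by norm_num) (by linarith)
    have a2 := near (u := i') (v := i) (r := 7 / 5) 2 (by norm_num) (by linarith)
    have a3 := near (u := j) (v := j') (r := 2 / 5) 1 (by norm_num) (by linarith)
    have a4 := near (u := j') (v := j) (r := 2 / 5) 1 (by norm_num) (by linarith)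
    rw [Nat.even_iff] at e e'
    omega
  · rw [if_pos e] at h1 h2 h3 h4
    rw [if_neg e'] at h5 h6 h7 h8
    have a1 := near (u := i) (v := i') (r := 9 / 10) 1 (by norm_num) (by linarith)
    have a2 := near (u := i') (v := i) (r := 9 / 10) 1 (by norm_num) (by linarith)
    have a3 := near (u := j) (v := j') (r := 9 / 10) 1 (by norm_num) (by linarith)
    have a4 := near (u := j') (v := j) (r := 9 / 10) 1 (by norm_num) (by linarith)
    omega
  · rw [if_neg e] at h1 h2 h3 h4
    rw [if_pos e'] at h5 h6 h7 h8
    have a1 := near (u := i) (v := i') (r := 9 / 10) 1 (by norm_num) (by linarith)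
    have a2 := near (u := i') (v := i) (r := 9 / 10) 1 (by norm_num) (by linarith)
    have a3 := near (u := j) (v := j') (r := 9 / 10) 1 (by norm_num) (by linarith)
    have a4 := near (u := j') (v := j) (r := 9 / 10) 1 (by norm_num) (by linarith)
    omega
  · rw [if_neg e] at h1 h2 h3 h4
    rw [if_neg e'] at h5 h6 h7 h8
    have a1 := near (u := i) (v := i') (r := 2 / 5) 1 (by norm_num) (by linarith)
    have a2 := near (u := i') (v := i) (r := 2 / 5) 1 (by norm_num) (by linarith)
    have a3 := near (u := j) (v := j') (r := 7 / 5) 2 (by norm_num) (by linarith)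
    have a4 := near (u := j') (v := j) (r := 7 / 5) 2 (by norm_num) (by linarith)
    rw [Nat.even_iff] at e e'
    omega

/-- The point between the four rectangles `weave u v` with `u ∈ {i, i + 1}`, `v ∈ {j, j + 1}`. -/
noncomputable def gap (i j : ℕ) : ℝ × ℝ := (i + 1 / 2, j + 1 / 2)

/-- A rectangle that contains the centre of a topping and a gap point meets the interior of another
topping. -/
theorem exists_mem_interior_weave {R : AxisRect} {i j i' j' : ℕ} (h : gap i j ∈ R.toSet)
    (h' : ((i' : ℝ), (j' : ℝ)) ∈ R.toSet) : ∃ u v : ℕ, (u = i ∨ u = i + 1) ∧ (v = j ∨ v = j + 1) ∧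
      (u, v) ≠ (i', j') ∧ ∃ p ∈ R.toSet, p ∈ interior (weave u v).toSet := by
  have key : ∀ {k l : ℕ}, ∃ w : ℕ, (w = l ∨ w = l + 1) ∧ ((k : ℝ) ≤ w ∧ (w : ℝ) ≤ l + 1 / 2 ∨
      (l : ℝ) + 1 / 2 ≤ w ∧ (w : ℝ) ≤ k) := by
    intro k l
    rcases le_or_gt k l with hkl | hkl
    · have : (k : ℝ) ≤ l := by exact_mod_cast hkl
      exact ⟨l, Or.inl rfl, Or.inl ⟨this, by linarith⟩⟩
    · have : ((l : ℝ) + 1) ≤ k := by exact_mod_cast hkl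
      exact ⟨l + 1, Or.inr rfl, Or.inr ⟨by push_cast; linarith, by push_cast; linarith⟩⟩
  -- The centre `(u, v)` lies between the gap and the given centre. If it is the given centre, the
  -- perpendicular neighbour across the gap is met instead.
  obtain ⟨u, hu, hux⟩ := key (k := i') (l := i)
  obtain ⟨v, hv, hvy⟩ := key (k := j') (l := j)
  by_cases hne : (u, v) = (i', j')
  · obtain ⟨rfl, rfl⟩ := Prod.mk.inj hne
    by_cases e : Even (u + v)
    · obtain ⟨w, hw, hwv⟩ : ∃ w, (w = j ∨ w = j + 1) ∧ (w = v + 1 ∨ w + 1 = v) := by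
        rcases hv with rfl | rfl
        · exact ⟨v + 1, Or.inr rfl, Or.inl rfl⟩
        · exact ⟨j, Or.inl rfl, Or.inr rfl⟩
      have e' : ¬ Even (u + w) := by
        rw [Nat.even_iff] at *
        omega
      refine ⟨u, w, hu, hw, fun h => ?_, ((u : ℝ), (j : ℝ) + 1 / 2),
        mk_mem_toSet h' h, ?_⟩
      · have := (Prod.mk.inj h).2
        omega
      · refine mem_interior_weave_of_not_even e' ?_ ?_ ?_ ?_
        · linarith
        · linarith
        · rcases hw with rfl | rfl <;> push_cast <;> linarith
        · rcases hw with rfl | rfl <;> push_cast <;> linarith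
    · obtain ⟨w, hw, hwv⟩ : ∃ w, (w = i ∨ w = i + 1) ∧ (w = u + 1 ∨ w + 1 = u) := by
        rcases hu with rfl | rfl
        · exact ⟨u + 1, Or.inr rfl, Or.inl rfl⟩
        · exact ⟨i, Or.inl rfl, Or.inr rfl⟩
      have e' : Even (w + v) := by
        rw [Nat.even_iff] at *
        omega
      refine ⟨w, v, hw, hv, fun h => ?_, ((i : ℝ) + 1 / 2, (v : ℝ)),
        mk_mem_toSet h h', ?_⟩
      · have := (Prod.mk.inj h).1
        omega
      · refine mem_interior_weave_of_even e' ?_ ?_ ?_ ?_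
        · rcases hw with rfl | rfl <;> push_cast <;> linarith
        · rcases hw with rfl | rfl <;> push_cast <;> linarith
        · linarith
        · linarith
  · exact ⟨u, v, hu, hv, hne, _, mem_toSet_of_le h' h (by simpa only [gap] using hux)
      (by simpa only [gap] using hvy), center_mem_interior_weave u v⟩

/-- A rectangle that contains two gap points meets the interior of a topping. -/
theorem exists_mem_interior_weave_of_gap {R : AxisRect} {i j i' j' : ℕ} (h : gap i j ∈ R.toSet)
    (h' : gap i' j' ∈ R.toSet) (hlt : i < i' ∨ j < j') :
    ∃ u v : ℕ, (u = i ∨ u = i + 1) ∧ (v = j ∨ v = j + 1) ∧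
      ∃ p ∈ R.toSet, p ∈ interior (weave u v).toSet := by
  rcases hlt with hlt | hlt
  · have hc : (i : ℝ) + 1 ≤ i' := by exact_mod_cast hlt
    -- Of the two toppings in column `i + 1` beside the gap, the vertical one passes height `j + 1 /
    -- 2`.
    obtain ⟨v, hv, e⟩ : ∃ v, (v = j ∨ v = j + 1) ∧ ¬ Even (i + 1 + v) := by
      by_cases e : Even (i + 1 + j)
      · exact ⟨j + 1, Or.inr rfl, by rw [Nat.even_iff] at *; omega⟩
      · exact ⟨j, Or.inl rfl, e⟩
    refine ⟨i + 1, v, Or.inr rfl, hv, ((i : ℝ) + 1, (j : ℝ) + 1 / 2), mem_toSet_of_le h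
      (mk_mem_toSet h' h) (Or.inl ⟨by simp only [gap]; linarith, by simp only [gap]; linarith⟩)
      (Or.inl ⟨le_rfl, le_rfl⟩), ?_⟩
    refine mem_interior_weave_of_not_even e ?_ ?_ ?_ ?_
    · push_cast; linarith
    · push_cast; linarith
    · rcases hv with rfl | rfl <;> push_cast <;> linarith
    · rcases hv with rfl | rfl <;> push_cast <;> linarith
  · have hc : (j : ℝ) + 1 ≤ j' := by exact_mod_cast hlt
    obtain ⟨u, hu, e⟩ : ∃ u, (u = i ∨ u = i + 1) ∧ Even (u + (j + 1)) := by
      by_cases e : Even (i + (j + 1))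
      · exact ⟨i, Or.inl rfl, e⟩
      · exact ⟨i + 1, Or.inr rfl, by rw [Nat.even_iff] at *; omega⟩
    refine ⟨u, j + 1, hu, Or.inr rfl, ((i : ℝ) + 1 / 2, (j : ℝ) + 1), mem_toSet_of_le h
      (mk_mem_toSet h h') (Or.inl ⟨le_rfl, le_rfl⟩)
      (Or.inl ⟨by simp only [gap]; linarith, by simp only [gap]; linarith⟩), ?_⟩
    refine mem_interior_weave_of_even e ?_ ?_ ?_ ?_
    · rcases hu with rfl | rfl <;> push_cast <;> linarith
    · rcases hu with rfl | rfl <;> push_cast <;> linarith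
    · push_cast; linarith
    · push_cast; linarith

end AxisRect

/-! ### Tightness of the bound -/

namespace AxisRect

/-- The cake for `m` toppings in rows of length `c`. -/
def weaveCake (c m : ℕ) (hc : 0 < c) : AxisRect where
  left := -1
  right := c
  bottom := -1
  top := m + 1
  left_lt_right := by
    have : (0 : ℝ) < c := by exact_mod_cast hc
    linarith
  bottom_lt_top := by
    have : (0 : ℝ) ≤ m := Nat.cast_nonneg m
    linarith

theorem weave_subset_weaveCake {c m i j : ℕ} (hi : i < c) (hj : j ≤ m) :
    (weave i j).toSet ⊆ (weaveCake c m (i.zero_le.trans_lt hi)).toSet := by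
  have h1 : (i : ℝ) + 1 ≤ c := by exact_mod_cast hi
  have h2 : (j : ℝ) ≤ m := by exact_mod_cast hj
  have h3 : (0 : ℝ) ≤ i := Nat.cast_nonneg i
  have h4 : (0 : ℝ) ≤ j := Nat.cast_nonneg j
  rw [toSet_subset_iff]
  simp only [weave, weaveCake]
  refine ⟨?_, ?_, ?_, ?_⟩ <;> split_ifs <;> linarith

theorem gap_mem_weaveCake {c m i j : ℕ} (hi : i < c) (hi' : i + 1 < c) (hj : j ≤ m) :
    gap i j ∈ (weaveCake c m (i.zero_le.trans_lt hi)).toSet := by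
  have h1 : (i : ℝ) + 1 + 1 ≤ c := by exact_mod_cast hi'
  have h2 : (j : ℝ) ≤ m := by exact_mod_cast hj
  have h3 : (0 : ℝ) ≤ i := Nat.cast_nonneg i
  have h4 : (0 : ℝ) ≤ j := Nat.cast_nonneg j
  rw [toSet, mem_prod, mem_Icc, mem_Icc]
  simp only [gap, weaveCake]
  refine ⟨⟨?_, ?_⟩, ?_, ?_⟩ <;> linarith

/-- Every gap between four toppings of the basket weave needs a blank of its own. -/
theorem le_of_hasPartitionWithBlanks_weave {c m M N b : ℕ} (hc : 0 < c) (hm : m ≤ c * M)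
    (hN : N + c + M = m + 1)
    (h : (weaveCake c m hc).HasPartitionWithBlanks (fun t : Fin m => weave (t % c) (t / c)) b) :
    N ≤ b := by
  obtain ⟨P, hP, hZ⟩ := h
  have htop : ∀ {i j : ℕ} (_ : i < c) (ht : j * c + i < m),
      interior (weave i j).toSet ⊆ interior (P (Fin.castAdd b ⟨j * c + i, ht⟩)).toSet := by
    intro i j hi ht
    refine interior_mono (subset_trans (Eq.subset ?_) (hZ ⟨j * c + i, ht⟩))
    have h1 : (j * c + i) % c = i := by
      rw [Nat.add_comm, Nat.add_mul_mod_self_right, Nat.mod_eq_of_lt hi]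
    have h2 : (j * c + i) / c = j := by
      rw [Nat.add_comm, Nat.add_mul_div_right _ _ hc, Nat.div_eq_of_lt hi, Nat.zero_add]
    simp only [h1, h2]
  have hcover : ∀ {i j : ℕ}, i + 1 < c → j ≤ m → ∃ k, gap i j ∈ (P k).toSet := by
    intro i j hi hj
    have := gap_mem_weaveCake (Nat.lt_of_succ_lt hi) hi hj
    rw [← hP.iUnion_eq] at this
    exact mem_iUnion.1 this
  -- `(j + 1) * c + (i + 1)` is the last index of the four toppings around the gap, so all four are
  -- present.
  have hblank : ∀ {i j : ℕ}, i + 1 < c → (j + 1) * c + (i + 1) < m →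
      ∃ k, gap i j ∈ (P (Fin.natAdd m k)).toSet := by
    intro i j hi hj
    have hj' : j ≤ m := by nlinarith
    obtain ⟨k, hk⟩ := hcover hi hj'
    revert hk
    refine Fin.addCases (fun t hk => ?_) (fun k hk => ⟨k, hk⟩) k
    exfalso
    have hcen : (((t % c : ℕ) : ℝ), ((t / c : ℕ) : ℝ)) ∈ (P (Fin.castAdd b t)).toSet :=
      hZ t (interior_subset (center_mem_interior_weave _ _))
    obtain ⟨u, v, hu, hv, hne, p, hp, hp'⟩ := exists_mem_interior_weave hk hcen
    have huc : u < c := by omega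
    have hvm : v * c + u < m := by
      have : v * c ≤ (j + 1) * c := Nat.mul_le_mul_right c (by omega)
      omega
    have := hP.eq_of_mem hp (htop huc hvm hp')
    have h1 : t = ⟨v * c + u, hvm⟩ := Fin.castAdd_injective _ _ this
    apply hne
    rw [h1]
    have h1 : (v * c + u) % c = u := by
      rw [Nat.add_comm, Nat.add_mul_mod_self_right, Nat.mod_eq_of_lt huc]
    have h2 : (v * c + u) / c = v := by
      rw [Nat.add_comm, Nat.add_mul_div_right _ _ hc, Nat.div_eq_of_lt huc, Nat.zero_add]
    simp only [h1, h2]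
  have hinj : ∀ {i j i' j' : ℕ} {k : Fin b}, i + 1 < c → (j + 1) * c + (i + 1) < m →
      gap i j ∈ (P (Fin.natAdd m k)).toSet → gap i' j' ∈ (P (Fin.natAdd m k)).toSet →
      ¬ (i < i' ∨ j < j') := by
    intro i j i' j' k hi hj h1 h2 hlt
    obtain ⟨u, v, hu, hv, p, hp, hp'⟩ := exists_mem_interior_weave_of_gap h1 h2 hlt
    have huc : u < c := by omega
    have hvm : v * c + u < m := by
      have : v * c ≤ (j + 1) * c := Nat.mul_le_mul_right c (by omega)
      omega
    have := congrArg Fin.val (hP.eq_of_mem hp (htop huc hvm hp'))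
    rw [Fin.val_natAdd, Fin.val_castAdd] at this
    change m + k = v * c + u at this
    omega
  obtain ⟨w, rfl⟩ : ∃ w, c = w + 1 := ⟨c - 1, by omega⟩
  -- There are `w = c - 1` gaps per row; the first `N` in row order have all four toppings even if
  -- the last row is incomplete.
  have hgrid : ∀ s : Fin N, s % w + 1 < w + 1 ∧ (s / w + 1) * (w + 1) + (s % w + 1) < m := by
    intro s
    obtain ⟨s, hs⟩ := s
    have hM : 0 < M := by
      rcases Nat.eq_zero_or_pos M with rfl | hM
      · omega
      · exact hM
    obtain ⟨r, rfl⟩ : ∃ r, M = r + 1 := ⟨M - 1, by omega⟩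
    have hNw : N ≤ w * r := by
      have : (w + 1) * (r + 1) = w * r + w + r + 1 := by ring
      omega
    have hw : 0 < w := by
      rcases Nat.eq_zero_or_pos w with rfl | hw
      · simp at hNw
        omega
      · exact hw
    have h1 : s % w < w := Nat.mod_lt s hw
    have h2 : s / w < r := Nat.div_lt_of_lt_mul (hs.trans_le hNw)
    have h3 := Nat.div_add_mod s w
    refine ⟨by simpa using h1, ?_⟩
    simp only
    have h4 : (s / w + 1) * (w + 1) = w * (s / w) + s / w + w + 1 := by ring
    omega
  choose f hf using fun s : Fin N => hblank (hgrid s).1 (hgrid s).2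
  have hfinj : Function.Injective f := by
    intro s s' hss
    have h1 := hf s
    have h2 := hf s'
    rw [hss] at h1
    have h3 := hinj (hgrid s).1 (hgrid s).2 h1 h2
    have h4 := hinj (hgrid s').1 (hgrid s').2 h2 h1
    have h5 : (s : ℕ) % w = s' % w := by omega
    have h6 : (s : ℕ) / w = s' / w := by omega
    refine Fin.ext ?_
    rw [← Nat.div_add_mod (s : ℕ) w, ← Nat.div_add_mod (s' : ℕ) w, h5, h6]
  simpa using Fintype.card_le_of_injective f hfinj

theorem exists_nat_ceil_two_mul_sqrt {m : ℕ} (hm : 0 < m) :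
    ∃ n : ℕ, (n : ℤ) = ⌈2 * √(m : ℝ) - 1⌉ + 1 ∧ 4 * m ≤ n ^ 2 ∧ n ≤ m + 1 ∧ 2 ≤ n := by
  have h0 : (0 : ℝ) ≤ 2 * √(m : ℝ) := by positivity
  have hsq : √(m : ℝ) ^ 2 = m := Real.sq_sqrt (Nat.cast_nonneg m)
  have h1 : (1 : ℝ) ≤ √(m : ℝ) := Real.one_le_sqrt.2 (by exact_mod_cast hm)
  have hle := Nat.le_ceil (2 * √(m : ℝ))
  refine ⟨⌈2 * √(m : ℝ)⌉₊, ?_, ?_, ?_, ?_⟩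
  · rw [Int.natCast_ceil_eq_ceil h0, Int.ceil_sub_one]
    ring
  · have : (4 * m : ℝ) ≤ (⌈2 * √(m : ℝ)⌉₊ : ℝ) ^ 2 := by
      calc (4 * m : ℝ) = (2 * √(m : ℝ)) ^ 2 := by rw [mul_pow, hsq]; ring
        _ ≤ _ := pow_le_pow_left₀ h0 hle 2
    exact_mod_cast this
  · rw [Nat.ceil_le]
    push_cast
    nlinarith [sq_nonneg (√(m : ℝ) - 1)]
  · have : (2 : ℝ) ≤ (⌈2 * √(m : ℝ)⌉₊ : ℝ) := by linarith
    exact_mod_cast this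

theorem exists_isLeast_blanks (m : ℕ) :
    ∃ (C : AxisRect) (Z : Fin m → AxisRect),
      (∀ i, (Z i).toSet ⊆ C.toSet) ∧
      (Pairwise fun i j => Disjoint (Z i).toSet (Z j).toSet) ∧
      ∃ b : ℕ, (b : ℤ) = (m : ℤ) - ⌈2 * √(m : ℝ) - 1⌉ ∧
        IsLeast {b' : ℕ | C.HasPartitionWithBlanks Z b'} b := by
  rcases Nat.eq_zero_or_pos m with rfl | hm
  · refine ⟨weave 0 0, Fin.elim0, fun i => i.elim0, fun i => i.elim0, 1, by simp [Int.ceil_neg],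
      hasPartitionWithBlanks_one_of_isEmpty _ _, fun b hb => ?_⟩
    by_contra hlt
    obtain rfl : b = 0 := by omega
    obtain ⟨P, hP, -⟩ := hb
    have hcen := interior_subset (center_mem_interior_weave 0 0)
    rw [← hP.iUnion_eq] at hcen
    obtain ⟨i, -⟩ := mem_iUnion.1 hcen
    exact i.elim0
  obtain ⟨n, hn, hmn, hnm, hn2⟩ := exists_nat_ceil_two_mul_sqrt hm
  have hc : 0 < n / 2 := by omega
  -- The most balanced factors with sum `n` have product `⌊n ^ 2 / 4⌋`, which is at least `m`.
  have hcM : m ≤ n / 2 * (n - n / 2) := by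
    rcases Nat.even_or_odd' n with ⟨k, rfl | rfl⟩
    · have h1 : 2 * k / 2 = k := by omega
      have h2 : 2 * k - k = k := by omega
      have h3 : (2 * k) ^ 2 = 4 * (k * k) := by ring
      rw [h1, h2]
      omega
    · have h1 : (2 * k + 1) / 2 = k := by omega
      have h2 : 2 * k + 1 - k = k + 1 := by omega
      have h3 : (2 * k + 1) ^ 2 = 4 * (k * (k + 1)) + 1 := by ring
      rw [h1, h2]
      omega
  have hZC : ∀ t : Fin m, (weave (t % (n / 2)) (t / (n / 2))).toSet ⊆
      (weaveCake (n / 2) m hc).toSet := fun t =>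
    weave_subset_weaveCake (Nat.mod_lt _ hc) ((Nat.div_le_self _ _).trans t.2.le)
  have hdisj : Pairwise fun s t : Fin m => Disjoint (weave (s % (n / 2)) (s / (n / 2))).toSet
      (weave (t % (n / 2)) (t / (n / 2))).toSet := by
    intro s t hst
    rw [disjoint_left]
    intro p hp hp'
    obtain ⟨h1, h2⟩ := eq_of_mem_weave hp hp'
    apply hst
    refine Fin.ext ?_
    rw [← Nat.div_add_mod (s : ℕ) (n / 2), ← Nat.div_add_mod (t : ℕ) (n / 2), h1, h2]
  have hlower : ∀ b, (weaveCake (n / 2) m hc).HasPartitionWithBlanks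
      (fun t : Fin m => weave (t % (n / 2)) (t / (n / 2))) b → m + 1 - n ≤ b := fun b hb =>
    le_of_hasPartitionWithBlanks_weave hc hcM (by omega) hb
  -- The upper bound supplies a partition attaining the lower bound.
  obtain ⟨b, hb, hpart⟩ := exists_hasPartitionWithBlanks _ _ hZC fun s t hst =>
    (hdisj hst).mono interior_subset interior_subset
  have h1 := hlower b hpart
  have h2 : b = m + 1 - n := by omega
  exact ⟨_, _, hZC, hdisj, b, by omega, hpart, fun b' hb' => h2 ▸ hlower b' hb'⟩

end AxisRect

theorem theorem4 (m : ℕ) :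
    (∀ (C : AxisRect) (Z : Fin m → AxisRect),
      (∀ i, (Z i).toSet ⊆ C.toSet) →
      (Pairwise fun i j => (Z i).InteriorDisjoint (Z j)) →
      ∃ b : ℕ, (b : ℤ) ≤ (m : ℤ) - ⌈2 * √(m : ℝ) - 1⌉ ∧ C.HasPartitionWithBlanks Z b) ∧
    (∃ (C : AxisRect) (Z : Fin m → AxisRect),
      (∀ i, (Z i).toSet ⊆ C.toSet) ∧
      (Pairwise fun i j => Disjoint (Z i).toSet (Z j).toSet) ∧
      ∃ b : ℕ, (b : ℤ) = (m : ℤ) - ⌈2 * √(m : ℝ) - 1⌉ ∧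
        IsLeast {b' : ℕ | C.HasPartitionWithBlanks Z b'} b) :=
  ⟨fun C Z => AxisRect.exists_hasPartitionWithBlanks C Z, AxisRect.exists_isLeast_blanks m⟩
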